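/- Let $X$ be a finite-dimensional smooth manifold (Hausdorff, second countable, without boundary) and $Y\to X$ a smooth real vector bundle of finite rank. Let $Y(X)$ be the $C^\infty(X)$-module of its smooth global sections, and let $\mathcal D(Y)\subset Y(X)$ be the submodule of sections with compact support, endowed with its $LF$-topology, i.e. the locally convex inductive limit of the Fréchet spaces $\mathcal D_K(Y)$ of sections supported in compact sets $K\subset X$ (with uniform convergence of all derivatives). Let $\mathcal D(Y)'$ be the topological dual of $\mathcal D(Y)$ with the strong topology (the space of Schwartz distributions), which is a $C^\infty(X)$-module by $\langle s,f\psi\rangle=\langle fs,\psi\rangle$. For $C^\infty(X)$-modules $P,Q$, an $\mathbb R$-linear map $\Delta:P\to Q$ is a $k$-order differential operator if $\delta_{a_0}\circ\cdots\circ\delta_{a_k}\Delta=0$ for all $a_0,\dots,a_k\in C^\infty(X)$, where $(\delta_a\Phi)(p)=a\Phi(p)-\Phi(ap)$; these operators form a $C^\infty(X)$-module $\mathrm{Dif}_k(P,Q)$ (with $(a\Delta)(p)=a\Delta(p)$). A differential operator is a $k$-order one for some $k\in\mathbb N$. The transpose of a continuous endomorphism $D$ of $\mathcal D(Y)$ is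 $D':\mathcal D(Y)'\to\mathcal D(Y)'$, $D'(\psi)=\psi\circ D$. Let $J^kY\to X$ be the bundle of $k$-order jets of sections of $Y$, and let $j^k_xs\in J^k_xY$ denote the $k$-jet of a section $s$ at $x$. 1. A $\mathcal D(Y)'$-valued differential operator on $\mathcal D(Y)'$ is the transpose of a continuous $\mathcal D(Y)$-valued differential operator on $\mathcal D(Y)$ if and only if it is continuous. 2. For every $k\in\mathbb N$: every element of $\mathrm{Dif}_k(\mathcal D(Y),\mathcal D(Y))$ is continuous, and $D\mapsto D'$ is a bijection of $\mathrm{Dif}_k(\mathcal D(Y),\mathcal D(Y))$ onto the set of continuous elements of $\mathrm{Dif}_k(\mathcal D(Y)',\mathcal D(Y)')$. Moreover, there is a $C^\infty(X)$-module isomorphism $((J^kY)^*\otimes Y)(X)\to\mathrm{Dif}_k(\mathcal D(Y),\mathcal D(Y))$ from the module of smooth global sections of $(J^kY)^*\otimes Y$, which sends a section $A$ to the operator $s\mapsto (x\mapsto A_x(j^k_xs))$, where an element of $(J^k_xY)^*\otimes Y_x$ is regarded as a linear map $J^k_xY\to Y_x$. Hence the continuous $k$-order differential operators on $\mathcal D(Y)'$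 are in one-to-one correspondence with the sections of $(J^kY)^*\otimes Y$. -/

import Mathlib

open scoped Manifold ContDiff Bundle NNReal TensorProduct

noncomputable section

set_option linter.unusedSectionVars false

namespace DistOp

/-! ### Differential operators on modules over a commutative ring -/

section Algebraic

variable {K A P Q : Type*} [CommRing K] [CommRing A] [Algebra K A]
  [AddCommGroup P] [Module K P] [Module A P] [IsScalarTower K A P]
  [AddCommGroup Q] [Module K Q] [Module A Q] [IsScalarTower K A Q]

/-- `δ_a Φ = a Φ - Φ ∘ a` for `a ∈ A` and a `K`-linear map `Φ : P → Q`. -/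
def delta (a : A) : (P →ₗ[K] Q) →ₗ[A] (P →ₗ[K] Q) where
  toFun Φ := a • Φ - Φ ∘ₗ (Algebra.lsmul K K P a)
  map_add' Φ Ψ := by
    ext p
    simp
    abel
  map_smul' b Φ := by
    ext p
    simp [smul_sub, smul_smul, mul_comm]

variable (K A P Q) in
/-- The `A`-module `Dif_k(P, Q)` of `k`-order `Q`-valued differential operators on `P`: the
`K`-linear maps `Δ` with `δ_{a_0} (δ_{a_1} (⋯ (δ_{a_k} Δ))) = 0` for all `a_0, …, a_k ∈ A`. -/
def diffOps (k : ℕ) : Submodule A (P →ₗ[K] Q) where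
  carrier := {Δ | ∀ a : Fin (k + 1) → A, (List.ofFn a).foldr (fun b Φ => delta b Φ) Δ = 0}
  zero_mem' := by
    intro a
    induction List.ofFn a with
    | nil => rfl
    | cons b l ih => rw [List.foldr_cons, ih, map_zero]
  add_mem' := by
    intro Φ Ψ hΦ hΨ a
    have h : ∀ l : List A, l.foldr (fun b Φ => delta b Φ) (Φ + Ψ) =
        l.foldr (fun b Φ => delta b Φ) Φ + l.foldr (fun b Φ => delta b Φ) Ψ := by
      intro l
      induction l with
      | nil => rfl
      | cons b l ih => rw [List.foldr_cons, List.foldr_cons, List.foldr_cons, ih, map_add]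
    rw [h, hΦ a, hΨ a, add_zero]
  smul_mem' := by
    intro c Φ hΦ a
    have h : ∀ l : List A, l.foldr (fun b Φ => delta b Φ) (c • Φ) =
        c • l.foldr (fun b Φ => delta b Φ) Φ := by
      intro l
      induction l with
      | nil => rfl
      | cons b l ih => rw [List.foldr_cons, List.foldr_cons, ih, map_smul]
    rw [h, hΦ a, smul_zero]

variable (K A P Q) in
/-- A differential operator (of some finite order). -/
def IsDiffOp (Δ : P →ₗ[K] Q) : Prop := ∃ k : ℕ, Δ ∈ diffOps K A P Q k

end Algebraic

section Geometry

variable (E : Type*) [NormedAddCommGroup E] [NormedSpace ℝ E]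
  {X : Type*} [TopologicalSpace X] [ChartedSpace E X] [IsManifold 𝓘(ℝ, E) ∞ X]
  (F : Type*) [NormedAddCommGroup F] [NormedSpace ℝ F]
  (V : X → Type*) [TopologicalSpace (Bundle.TotalSpace F V)]
  [∀ x, AddCommGroup (V x)] [∀ x, Module ℝ (V x)] [∀ x, TopologicalSpace (V x)]
  [FiberBundle F V] [VectorBundle ℝ F V] [ContMDiffVectorBundle ∞ F V 𝓘(ℝ, E)]

/-- The ring `C^∞(X)` of smooth real functions. -/
abbrev SmoothFun (E : Type*) [NormedAddCommGroup E] [NormedSpace ℝ E]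
    (X : Type*) [TopologicalSpace X] [ChartedSpace E X] : Type _ :=
  C^∞⟮𝓘(ℝ, E), X; 𝓘(ℝ, ℝ), ℝ⟯

/-- The space `Y(X)` of smooth global sections of the vector bundle `Y = (V x)_x`. -/
abbrev Sections : Type _ := Cₛ^∞⟮𝓘(ℝ, E); F, V⟯

/-! ### `Y(X)` as a `C^∞(X)`-module -/

instance sectionsSMul : SMul (SmoothFun E X) (Sections E F V) where
  smul f s := ⟨fun x => f x • s x, f.contMDiff.smul_section s.contMDiff⟩

@[simp] theorem sections_smul_apply (f : SmoothFun E X) (s : Sections E F V) (x : X) :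
    (f • s) x = f x • s x := rfl

instance sectionsModule : Module (SmoothFun E X) (Sections E F V) where
  one_smul s := ContMDiffSection.ext fun x => one_smul ℝ (s x)
  mul_smul f g s := ContMDiffSection.ext fun x => mul_smul (f x) (g x) (s x)
  smul_zero f := ContMDiffSection.ext fun x => smul_zero (f x)
  smul_add f s t := ContMDiffSection.ext fun x => smul_add (f x) (s x) (t x)
  add_smul f g s := ContMDiffSection.ext fun x => add_smul (f x) (g x) (s x)
  zero_smul s := ContMDiffSection.ext fun x => zero_smul ℝ (s x)

instance sectionsTower : IsScalarTower ℝ (SmoothFun E X) (Sections E F V) where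
  smul_assoc c f s := ContMDiffSection.ext fun x => smul_assoc c (f x) (s x)

/-! ### Sections with compact support -/

variable {E F V} in
/-- The support of a section: the closure of the set of points where it does not vanish. -/
def sectionSupport (s : Sections E F V) : Set X := closure {x | s x ≠ 0}

/-- The `C^∞(X)`-module `𝒟(Y)` of smooth sections with compact support. -/
def testSections : Submodule (SmoothFun E X) (Sections E F V) where
  carrier := {s | IsCompact (sectionSupport s)}
  zero_mem' := by
    simp [sectionSupport]
  add_mem' := by
    intro s t hs ht
    refine (hs.union ht).of_isClosed_subset isClosed_closure ?_
    refine (closure_mono fun x hx => ?_).trans closure_union.subset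
    by_contra h
    simp only [Set.mem_union, Set.mem_ofPred_eq, not_or, not_not] at h
    exact hx (by simp [h.1, h.2])
  smul_mem' := by
    intro f s hs
    refine hs.of_isClosed_subset isClosed_closure (closure_mono fun x hx h => hx ?_)
    simp [h]

/-! ### Local expressions of sections and of their derivatives -/

/-- The open set on which both the preferred chart of `X` at `x₀` and the preferred
trivialization of `Y` at `x₀` are defined. -/
def localDomain (x₀ : X) : Set X :=
  (chartAt E x₀).source ∩ (trivializationAt F V x₀).baseSet

variable {E F V} in
/-- The local expression of a section in the chart and the trivialization at `x₀`, a function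
on the model space that is meaningful on the image of `localDomain E F V x₀`. -/
def localRep (x₀ : X) (s : Sections E F V) : E → F :=
  fun y => (trivializationAt F V x₀ ⟨(chartAt E x₀).symm y, s ((chartAt E x₀).symm y)⟩).2

variable {E F V} in
/-- The `n`-th derivative at the point `x` of the local expression of a section in the chart and
the trivialization at `x₀`. -/
def localDeriv (x₀ : X) (n : ℕ) (x : X) (s : Sections E F V) : E [×n]→L[ℝ] F :=
  iteratedFDeriv ℝ n (localRep x₀ s) (chartAt E x₀ x)

/-- The image of `localDomain E F V x₀` in the chart at `x₀`. -/
def localTarget (x₀ : X) : Set E :=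
  (chartAt E x₀).target ∩ (chartAt E x₀).symm ⁻¹' (trivializationAt F V x₀).baseSet

theorem isOpen_localTarget (x₀ : X) : IsOpen (localTarget E F V x₀) :=
  (chartAt E x₀).isOpen_inter_preimage_symm (trivializationAt F V x₀).open_baseSet

theorem mem_localTarget {x₀ x : X} (hx : x ∈ localDomain E F V x₀) :
    chartAt E x₀ x ∈ localTarget E F V x₀ :=
  ⟨(chartAt E x₀).map_source hx.1, by
    rw [Set.mem_preimage, (chartAt E x₀).left_inv hx.1]
    exact hx.2⟩

theorem mem_localDomain_self (x : X) : x ∈ localDomain E F V x :=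
  ⟨mem_chart_source E x, FiberBundle.mem_baseSet_trivializationAt' x⟩

theorem contDiffOn_localRep (x₀ : X) (s : Sections E F V) :
    ContDiffOn ℝ ∞ (localRep x₀ s) (localTarget E F V x₀) := by
  rw [← contMDiffOn_iff_contDiffOn]
  have h1 := ((trivializationAt F V x₀).contMDiffOn_section_baseSet_iff
    (IB := 𝓘(ℝ, E)) (n := ∞) (s := s)).1 s.contMDiff.contMDiffOn
  have h2 := contMDiffOn_chart_symm (I := 𝓘(ℝ, E)) (n := ∞) (x := x₀)
  exact h1.comp (h2.mono Set.inter_subset_left) Set.inter_subset_right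

theorem contDiffAt_localRep {x₀ x : X} (hx : x ∈ localDomain E F V x₀) (s : Sections E F V) :
    ContDiffAt ℝ ∞ (localRep x₀ s) (chartAt E x₀ x) :=
  (contDiffOn_localRep E F V x₀ s).contDiffAt
    ((isOpen_localTarget E F V x₀).mem_nhds (mem_localTarget E F V hx))

theorem localRep_add {x₀ : X} {y : E} (hy : y ∈ localTarget E F V x₀) (s t : Sections E F V) :
    localRep x₀ (s + t) y = localRep x₀ s y + localRep x₀ t y :=
  ((trivializationAt F V x₀).linear ℝ hy.2).map_add _ _

theorem localRep_smul {x₀ : X} {y : E} (hy : y ∈ localTarget E F V x₀) (f : SmoothFun E X)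
    (s : Sections E F V) :
    localRep x₀ (f • s) y = f ((chartAt E x₀).symm y) • localRep x₀ s y :=
  ((trivializationAt F V x₀).linear ℝ hy.2).map_smul _ _

theorem localRep_const_smul {x₀ : X} {y : E} (hy : y ∈ localTarget E F V x₀) (c : ℝ)
    (s : Sections E F V) : localRep x₀ (c • s) y = c • localRep x₀ s y :=
  ((trivializationAt F V x₀).linear ℝ hy.2).map_smul _ _

theorem localDeriv_add {x₀ x : X} (hx : x ∈ localDomain E F V x₀) (n : ℕ)
    (s t : Sections E F V) :
    localDeriv x₀ n x (s + t) = localDeriv x₀ n x s + localDeriv x₀ n x t := by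
  have h : localRep x₀ (s + t) =ᶠ[nhds (chartAt E x₀ x)] localRep x₀ s + localRep x₀ t := by
    filter_upwards [(isOpen_localTarget E F V x₀).mem_nhds (mem_localTarget E F V hx)] with y hy
    exact localRep_add E F V hy s t
  unfold localDeriv
  rw [(h.iteratedFDeriv ℝ n).eq_of_nhds]
  exact iteratedFDeriv_add_apply
    ((contDiffAt_localRep E F V hx s).of_le (by exact_mod_cast le_top))
    ((contDiffAt_localRep E F V hx t).of_le (by exact_mod_cast le_top))

theorem localDeriv_const_smul {x₀ x : X} (hx : x ∈ localDomain E F V x₀) (n : ℕ) (c : ℝ)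
    (s : Sections E F V) :
    localDeriv x₀ n x (c • s) = c • localDeriv x₀ n x s := by
  have h : localRep x₀ (c • s) =ᶠ[nhds (chartAt E x₀ x)] c • localRep x₀ s := by
    filter_upwards [(isOpen_localTarget E F V x₀).mem_nhds (mem_localTarget E F V hx)] with y hy
    exact localRep_const_smul E F V hy c s
  unfold localDeriv
  rw [(h.iteratedFDeriv ℝ n).eq_of_nhds]
  exact iteratedFDeriv_const_smul_apply
    ((contDiffAt_localRep E F V hx s).of_le (by exact_mod_cast le_top))

theorem localDeriv_zero (x₀ : X) {x : X} (hx : x ∈ localDomain E F V x₀) (n : ℕ) :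
    localDeriv x₀ n x (0 : Sections E F V) = 0 := by
  have := localDeriv_const_smul E F V hx n 0 (0 : Sections E F V)
  rwa [zero_smul, zero_smul] at this

/-- On a compact subset of `localDomain E F V x₀` the derivatives of a section are bounded. -/
theorem bddAbove_localDeriv {x₀ : X} (n : ℕ) {L : Set X} (hL : IsCompact L)
    (hLd : L ⊆ localDomain E F V x₀) (s : Sections E F V) :
    BddAbove (Set.range fun x : L => ‖localDeriv x₀ n (x : X) s‖) := by
  have hcont : ContinuousOn (fun x => ‖localDeriv x₀ n x s‖) L := by
    intro x hx
    have h1 : ContinuousAt (iteratedFDeriv ℝ n (localRep x₀ s)) (chartAt E x₀ x) :=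
      ((contDiffAt_localRep E F V (hLd hx) s).of_le (m := n)
        (by exact_mod_cast le_top)).continuousAt_iteratedFDeriv le_rfl
    have h2 : ContinuousAt (chartAt E x₀) x := (chartAt E x₀).continuousAt (hLd hx).1
    exact (ContinuousAt.comp (f := chartAt E x₀) h1 h2).norm.continuousWithinAt
  have := hL.bddAbove_image hcont
  rwa [Set.image_eq_range] at this

/-! ### The LF-topology on `𝒟(Y)` -/

/-- An index of one of the standard `C^∞`-seminorms: a point `x₀` of `X` (which determines a chart
and a trivialization), an order of derivation, and a compact set inside the domain of the chart and
the trivialization at `x₀`. -/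
structure SeminormIndex where
  /-- the point that determines the chart and the trivialization -/
  center : X
  /-- the order of derivation -/
  order : ℕ
  /-- the compact set -/
  carrier : Set X
  isCompact : IsCompact carrier
  subset : carrier ⊆ localDomain E F V center

variable {E F V} in
/-- The seminorm `s ↦ sup_{x ∈ L} ‖D^n s(x)‖` on `𝒟(Y)`, the derivative being taken in the chart
and the trivialization of the given index. -/
def smoothSeminorm (i : SeminormIndex E F V) : Seminorm ℝ (testSections E F V) :=
  Seminorm.of (fun s => ⨆ x : i.carrier, ‖localDeriv i.center i.order (x : X) s.1‖)
    (by
      intro s t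
      refine Real.iSup_le (fun x => ?_)
        (add_nonneg (Real.iSup_nonneg fun _ => norm_nonneg _)
          (Real.iSup_nonneg fun _ => norm_nonneg _))
      have h := localDeriv_add E F V (i.subset x.2) i.order s.1 t.1
      calc ‖localDeriv i.center i.order (x : X) (s + t).1‖
          = ‖localDeriv i.center i.order (x : X) s.1 + localDeriv i.center i.order (x : X) t.1‖ := by
            rw [← h]
            rfl
        _ ≤ _ := (norm_add_le _ _).trans (add_le_add
            (le_ciSup (bddAbove_localDeriv E F V i.order i.isCompact i.subset s.1) x)
            (le_ciSup (bddAbove_localDeriv E F V i.order i.isCompact i.subset t.1) x)))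
    (by
      intro c s
      rw [Real.mul_iSup_of_nonneg (norm_nonneg c)]
      refine congrArg _ (funext fun x => ?_)
      rw [← norm_smul, ← localDeriv_const_smul E F V (i.subset x.2)]
      rfl)

variable {E F V} in
/-- A seminorm `p` on `𝒟(Y)` whose restriction to the subspace `𝒟_K(Y)` of sections supported
in `K` is, for each compact `K`, continuous for the Fréchet topology of `𝒟_K(Y)` (uniform
convergence of all derivatives), i.e. is bounded on `𝒟_K(Y)` by finitely many of the standard
seminorms. -/
def IsLFSeminorm (p : Seminorm ℝ (testSections E F V)) : Prop :=
  ∀ K : Set X, IsCompact K → ∃ (t : Finset (SeminormIndex E F V)) (C : ℝ≥0),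
    ∀ s : testSections E F V, sectionSupport s.1 ⊆ K → p s ≤ C * t.sup smoothSeminorm s

/-- The family of all seminorms on `𝒟(Y)` that are continuous on each `𝒟_K(Y)`. -/
def lfSeminorms :
    SeminormFamily ℝ (testSections E F V) {p : Seminorm ℝ (testSections E F V) // IsLFSeminorm p} :=
  fun p => p.1

/-- The LF-topology on `𝒟(Y)`: the locally convex inductive limit of the Fréchet spaces `𝒟_K(Y)`,
`K ⊆ X` compact, i.e. the finest locally convex topology for which all the inclusions
`𝒟_K(Y) → 𝒟(Y)` are continuous. -/
instance testTopology : TopologicalSpace (testSections E F V) :=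
  (lfSeminorms E F V).moduleFilterBasis.topology

theorem test_withSeminorms : WithSeminorms (lfSeminorms E F V) := ⟨rfl⟩

instance testTopologicalAddGroup : IsTopologicalAddGroup (testSections E F V) :=
  (test_withSeminorms E F V).topologicalAddGroup

instance testContinuousSMul : ContinuousSMul ℝ (testSections E F V) :=
  (test_withSeminorms E F V).continuousSMul

instance testLocallyConvexSpace : LocallyConvexSpace ℝ (testSections E F V) :=
  (test_withSeminorms E F V).toLocallyConvexSpace

/-! ### Multiplication by smooth functions is continuous on `𝒟(Y)` -/

theorem contDiffOn_localFun (x₀ : X) (f : SmoothFun E X) :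
    ContDiffOn ℝ ∞ (fun y => f ((chartAt E x₀).symm y)) (localTarget E F V x₀) := by
  rw [← contMDiffOn_iff_contDiffOn]
  have h2 := contMDiffOn_chart_symm (I := 𝓘(ℝ, E)) (n := ∞) (x := x₀)
  exact f.contMDiff.comp_contMDiffOn (h2.mono Set.inter_subset_left)

theorem norm_localDeriv_smul_le {x₀ x : X} (hx : x ∈ localDomain E F V x₀) (n : ℕ)
    (f : SmoothFun E X) (s : Sections E F V) :
    ‖localDeriv x₀ n x (f • s)‖ ≤ ∑ j ∈ Finset.range (n + 1), (n.choose j : ℝ) *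
      ‖iteratedFDeriv ℝ j (fun y => f ((chartAt E x₀).symm y)) (chartAt E x₀ x)‖ *
        ‖localDeriv x₀ (n - j) x s‖ := by
  have hm := mem_localTarget E F V hx
  have hU := isOpen_localTarget E F V x₀
  have h : localRep x₀ (f • s) =ᶠ[nhds (chartAt E x₀ x)]
      fun y => f ((chartAt E x₀).symm y) • localRep x₀ s y := by
    filter_upwards [hU.mem_nhds hm] with y hy
    exact localRep_smul E F V hy f s
  have key := norm_iteratedFDerivWithin_smul_le (n := n) (contDiffOn_localFun E F V x₀ f)
    (contDiffOn_localRep E F V x₀ s) hU.uniqueDiffOn hm (by exact_mod_cast le_top)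
  simp only [iteratedFDerivWithin_of_isOpen _ hU hm] at key
  unfold localDeriv
  rw [(h.iteratedFDeriv ℝ n).eq_of_nhds]
  exact key

theorem exists_smoothSeminorm_smul_le (f : SmoothFun E X) (i : SeminormIndex E F V) :
    ∃ (t : Finset (SeminormIndex E F V)) (C : ℝ≥0), ∀ s : testSections E F V,
      smoothSeminorm i (f • s) ≤ C * t.sup smoothSeminorm s := by
  classical
  have hb : ∀ j : ℕ, ∃ c : ℝ≥0, ∀ x ∈ i.carrier,
      ‖iteratedFDeriv ℝ j (fun y => f ((chartAt E i.center).symm y))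
        (chartAt E i.center x)‖ ≤ c := by
    intro j
    have hc : ContinuousOn (fun x => iteratedFDeriv ℝ j
        (fun y => f ((chartAt E i.center).symm y)) (chartAt E i.center x)) i.carrier := by
      intro x hx
      have h1 := (((contDiffOn_localFun E F V i.center f).contDiffAt
        ((isOpen_localTarget E F V i.center).mem_nhds
          (mem_localTarget E F V (i.subset hx)))).of_le (m := j)
            (by exact_mod_cast le_top)).continuousAt_iteratedFDeriv le_rfl
      exact (ContinuousAt.comp (f := chartAt E i.center) h1
        ((chartAt E i.center).continuousAt (i.subset hx).1)).continuousWithinAt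
    obtain ⟨c, hc⟩ := i.isCompact.exists_bound_of_continuousOn hc
    exact ⟨c.toNNReal, fun x hx => (hc x hx).trans (Real.le_coe_toNNReal c)⟩
  choose c hc using hb
  let idx : ℕ → SeminormIndex E F V := fun j => ⟨i.center, i.order - j, i.carrier, i.isCompact,
    i.subset⟩
  refine ⟨(Finset.range (i.order + 1)).image idx,
    ∑ j ∈ Finset.range (i.order + 1), (i.order.choose j : ℝ≥0) * c j, fun s => ?_⟩
  refine Real.iSup_le (fun x => ?_) (mul_nonneg (NNReal.coe_nonneg _) (apply_nonneg _ _))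
  refine (norm_localDeriv_smul_le E F V (i.subset x.2) i.order f s.1).trans ?_
  push_cast
  rw [Finset.sum_mul]
  refine Finset.sum_le_sum fun j hj => ?_
  have h1 : ‖localDeriv i.center (i.order - j) (x : X) s.1‖ ≤ smoothSeminorm (idx j) s :=
    le_ciSup (bddAbove_localDeriv E F V (i.order - j) i.isCompact i.subset s.1) x
  have h2 : smoothSeminorm (idx j) s ≤
      ((Finset.range (i.order + 1)).image idx).sup smoothSeminorm s :=
    Seminorm.le_finset_sup_apply (Finset.mem_image_of_mem idx hj)
  have h3 := hc j x x.2
  have h4 : (0 : ℝ) ≤ i.order.choose j := Nat.cast_nonneg _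
  gcongr
  exact h1.trans h2

theorem isLFSeminorm_comp_smul (f : SmoothFun E X) {p : Seminorm ℝ (testSections E F V)}
    (hp : IsLFSeminorm p) : IsLFSeminorm (p.comp (Algebra.lsmul ℝ ℝ (testSections E F V) f)) := by
  classical
  intro K hK
  obtain ⟨t, C, h⟩ := hp K hK
  choose u B hu using exists_smoothSeminorm_smul_le E F V f
  refine ⟨t.biUnion u, C * ∑ i ∈ t, B i, fun s hs => ?_⟩
  have hfs : sectionSupport (f • s).1 ⊆ K := by
    refine Set.Subset.trans (closure_mono fun x (hx : (f • s).1 x ≠ 0) => ?_) hs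
    intro h0
    refine hx ?_
    change f x • s.1 x = 0
    rw [h0, smul_zero]
  refine (h (f • s) hfs).trans ?_
  rw [NNReal.coe_mul, mul_assoc]
  refine mul_le_mul_of_nonneg_left ?_ C.coe_nonneg
  refine Seminorm.finset_sup_apply_le (mul_nonneg (NNReal.coe_nonneg _) (apply_nonneg _ _)) ?_
  intro i hi
  refine (hu i s).trans (mul_le_mul ?_ ?_ (apply_nonneg _ _) (NNReal.coe_nonneg _))
  · exact_mod_cast Finset.single_le_sum (f := B) (fun _ _ => zero_le) hi
  · exact Seminorm.le_def.1 (Finset.sup_mono (Finset.subset_biUnion_of_mem u hi)) s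

variable {E} in
/-- Multiplication by `f ∈ C^∞(X)` as a continuous endomorphism of `𝒟(Y)`. -/
def mulCLM (f : SmoothFun E X) : testSections E F V →L[ℝ] testSections E F V where
  toLinearMap := Algebra.lsmul ℝ ℝ (testSections E F V) f
  cont := by
    refine (test_withSeminorms E F V).continuous_of_continuous_comp _ fun p => ?_
    exact (test_withSeminorms E F V).continuous_seminorm
      ⟨_, isLFSeminorm_comp_smul E F V f p.2⟩

/-! ### Schwartz distributions -/

/-- The space `𝒟(Y)'` of Schwartz distributions: the continuous linear forms on `𝒟(Y)`, with the
strong topology (uniform convergence on the bounded subsets of `𝒟(Y)`). -/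
abbrev Distributions : Type _ := testSections E F V →L[ℝ] ℝ

/-- The multiplication of distributions by smooth functions, `⟨s, f ψ⟩ = ⟨f s, ψ⟩`. -/
instance distributionsSMul : SMul (SmoothFun E X) (Distributions E F V) where
  smul f ψ := ψ.comp (mulCLM F V f)

theorem distributions_smul_apply (f : SmoothFun E X) (ψ : Distributions E F V)
    (s : testSections E F V) : (f • ψ) s = ψ (f • s) := rfl

instance distributionsModule : Module (SmoothFun E X) (Distributions E F V) where
  one_smul ψ := by
    ext s
    rw [distributions_smul_apply, one_smul]
  mul_smul f g ψ := by
    ext s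
    rw [distributions_smul_apply, distributions_smul_apply, distributions_smul_apply, smul_smul,
      mul_comm]
  smul_zero f := rfl
  smul_add f ψ χ := rfl
  add_smul f g ψ := by
    ext s
    rw [distributions_smul_apply, add_smul, map_add]
    rfl
  zero_smul ψ := by
    ext s
    rw [distributions_smul_apply, zero_smul, map_zero]
    rfl

instance distributionsTower : IsScalarTower ℝ (SmoothFun E X) (Distributions E F V) where
  smul_assoc c f ψ := by
    ext s
    rw [distributions_smul_apply, smul_assoc, map_smul]
    rfl

variable {E F V} in
/-- The transpose `Δ' : ψ ↦ ψ ∘ Δ` of a continuous endomorphism `Δ` of `𝒟(Y)`. -/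
def transpose (Δ : testSections E F V →L[ℝ] testSections E F V) :
    Distributions E F V →ₗ[ℝ] Distributions E F V where
  toFun ψ := ψ.comp Δ
  map_add' _ _ := rfl
  map_smul' _ _ := rfl

/-! ### Jets of sections and the sections of `(J^k Y)^* ⊗ Y` -/

/-- The sections of `Y` whose derivatives of order `≤ k` at `x` (in the chart and the
trivialization at `x`) vanish. -/
def jetKer (k : ℕ) (x : X) : Submodule ℝ (Sections E F V) where
  carrier := {s | ∀ i ≤ k, localDeriv x i x s = 0}
  zero_mem' i _ := localDeriv_zero E F V x (mem_localDomain_self E F V x) i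
  add_mem' {s t} hs ht i hi := by
    rw [localDeriv_add E F V (mem_localDomain_self E F V x), hs i hi, ht i hi, add_zero]
  smul_mem' c s hs i hi := by
    rw [localDeriv_const_smul E F V (mem_localDomain_self E F V x), hs i hi, smul_zero]

/-- The fibre `J^k_x Y` of the `k`-order jet bundle at `x`: two sections have the same `k`-jet at
`x` iff their derivatives of order `≤ k` at `x` agree. -/
abbrev JetFibre (k : ℕ) (x : X) : Type _ := Sections E F V ⧸ jetKer E F V k x

variable {E F V} in
/-- The `k`-jet `j^k_x s` of a section `s` at `x`. -/
def jet (k : ℕ) (x : X) : Sections E F V →ₗ[ℝ] JetFibre E F V k x := (jetKer E F V k x).mkQ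

/-- The not necessarily smooth sections of `(J^k Y)^* ⊗ Y → X`. -/
def RoughJetDualSections (k : ℕ) : Type _ :=
  (x : X) → Module.Dual ℝ (JetFibre E F V k x) ⊗[ℝ] V x

instance roughAddCommGroup (k : ℕ) : AddCommGroup (RoughJetDualSections E F V k) :=
  inferInstanceAs (AddCommGroup ((x : X) → Module.Dual ℝ (JetFibre E F V k x) ⊗[ℝ] V x))

instance roughModule (k : ℕ) : Module (SmoothFun E X) (RoughJetDualSections E F V k) where
  smul f A := fun x => f x • A x
  one_smul A := funext fun x => one_smul ℝ (A x)
  mul_smul f g A := funext fun x => mul_smul (f x) (g x) (A x)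
  smul_zero f := funext fun x => smul_zero (f x)
  smul_add f A B := funext fun x => smul_add (f x) (A x) (B x)
  add_smul f g A := funext fun x => add_smul (f x) (g x) (A x)
  zero_smul A := funext fun x => zero_smul ℝ (A x)

variable {E F V} in
/-- The value at `j ∈ J^k_x Y` of the linear map `J^k_x Y → Y_x` given by an element of
`(J^k_x Y)^* ⊗ Y_x`. -/
def contract {k : ℕ} {x : X} (A : Module.Dual ℝ (JetFibre E F V k x) ⊗[ℝ] V x) :
    JetFibre E F V k x →ₗ[ℝ] V x :=
  dualTensorHom ℝ (JetFibre E F V k x) (V x) A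

/-- The `C^∞(X)`-module of smooth sections of the vector bundle `(J^k Y)^* ⊗ Y → X`.
In the coordinates of `J^k Y` induced by the chart and the trivialization at a point `x₀`, the jet
`j^k_x s` has the components `D^i s(x)`, `i ≤ k`; a section of `(J^k Y)^* ⊗ Y` is smooth if, for each
`x₀`, its coefficients `a` in these coordinates are smooth functions of `x`. -/
def jetDualSections (k : ℕ) : Submodule (SmoothFun E X) (RoughJetDualSections E F V k) where
  carrier := {A | ∀ x₀ : X, ∃ a : X → ((i : Fin (k + 1)) → E [×(i : ℕ)]→L[ℝ] F) →L[ℝ] F,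
    ContMDiffOn 𝓘(ℝ, E) 𝓘(ℝ, ((i : Fin (k + 1)) → E [×(i : ℕ)]→L[ℝ] F) →L[ℝ] F) ∞ a
      (localDomain E F V x₀) ∧
    ∀ x ∈ localDomain E F V x₀, ∀ s : Sections E F V,
      (trivializationAt F V x₀ ⟨x, contract (A x) (jet k x s)⟩).2 =
        a x (fun i => localDeriv x₀ i x s)}
  zero_mem' x₀ := by
    refine ⟨0, contMDiffOn_const, fun x hx s => ?_⟩
    have h : contract ((0 : RoughJetDualSections E F V k) x) (jet k x s) = 0 := by
      change (dualTensorHom ℝ _ _ 0) _ = 0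
      rw [map_zero, LinearMap.zero_apply]
    rw [h]
    exact ((trivializationAt F V x₀).linear ℝ hx.2).map_zero
  add_mem' {A B} hA hB x₀ := by
    obtain ⟨a, ha, hA⟩ := hA x₀
    obtain ⟨b, hb, hB⟩ := hB x₀
    refine ⟨a + b, ha.add hb, fun x hx s => ?_⟩
    have h : contract ((A + B) x) (jet k x s) =
        contract (A x) (jet k x s) + contract (B x) (jet k x s) := by
      change (dualTensorHom ℝ _ _ (A x + B x)) _ = _
      rw [map_add, LinearMap.add_apply]
      rfl
    rw [h, Pi.add_apply, add_apply, ← hA x hx s, ← hB x hx s]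
    exact ((trivializationAt F V x₀).linear ℝ hx.2).map_add _ _
  smul_mem' f A hA x₀ := by
    obtain ⟨a, ha, hA⟩ := hA x₀
    refine ⟨fun x => f x • a x, f.contMDiff.contMDiffOn.smul ha, fun x hx s => ?_⟩
    have h : contract ((f • A) x) (jet k x s) = f x • contract (A x) (jet k x s) := by
      change (dualTensorHom ℝ _ _ (f x • A x)) _ = _
      rw [map_smul, LinearMap.smul_apply]
      rfl
    rw [h, smul_apply, ← hA x hx s]
    exact ((trivializationAt F V x₀).linear ℝ hx.2).map_smul _ _

end Geometry

end DistOp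

end

noncomputable section

set_option linter.unusedSectionVars false

namespace DistOp

/-! ### Iterated commutators and evaluation at a point -/

section IteratedDelta

variable {K A P Q : Type*} [CommRing K] [CommRing A] [Algebra K A]
  [AddCommGroup P] [Module K P] [Module A P] [IsScalarTower K A P]
  [AddCommGroup Q] [Module K Q] [Module A Q] [IsScalarTower K A Q]

/-! Local half. Fix a point `x`. Since evaluation at `x` turns multiplication by `a` into
multiplication by the number `a x`, an iterated commutator of `D` evaluated at `x` is, up to sign,
`D` applied to `∏ (a_i - a_i(x)) • s` and evaluated at `x` (`map_iterDelta_apply`). So an operator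
of order `k` kills, at `x`, every multiple of a product of `k + 1` functions vanishing at `x`. It
follows that `D` is local. By Taylor's formula with smooth remainder coefficients, `(D s)(x)` then
depends only on the `k`-jet of `s` at `x`. The same identity, read backwards on Taylor monomials,
expresses the coefficients of `D` through values at `x` of fixed sections, so they are smooth in `x`
(`exists_coefficients`). Conversely, a product of `k + 1` functions vanishing at `x` has zero
`k`-jet, so operators of the form `A_x(j^k_x s)` have order `k`. Continuity of `D` follows from
Leibniz estimates and from the fact that `D` does not enlarge supports.

Dual half. If `Δ` is a continuous endomorphism of the distributions, then for each test section `s`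
the form `ψ ↦ (Δ ψ)(s)` is continuous on the strong dual. The test space is semireflexive
(`exists_eval_of_continuous`), so this form is evaluation at some test section `D s`, and `D s` is
unique and linear in `s` because distributions separate test sections. Commutators of `Δ` pair with
those of `D` up to sign, so `Δ` and `D` have the same orders; `D` is then continuous by the local
half.

Semireflexivity combines three facts: a bounded set has a common compact support and bounded
derivatives (`exists_boundedTests`); the set cut out by such bounds is compact
(`isCompact_boundedTests`, an Arzelà–Ascoli argument along ultrafilters); and a linear form
dominated by the supremum over a compact convex symmetric set is evaluation at one of its points
(`exists_eval_of_le_on_compact`, by finite-dimensional separation and the finite intersection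
property). -/

@[simp] theorem delta_apply (a : A) (Φ : P →ₗ[K] Q) (p : P) :
    delta a Φ p = a • Φ p - Φ (a • p) := rfl

/-- The iterated commutator `δ_{a_0} (δ_{a_1} (⋯ Δ))` for a list `a_0, a_1, …`. -/
def iterDelta (l : List A) (Δ : P →ₗ[K] Q) : P →ₗ[K] Q :=
  l.foldr (fun b Φ => delta b Φ) Δ

@[simp] theorem iterDelta_nil (Δ : P →ₗ[K] Q) : iterDelta ([] : List A) Δ = Δ := rfl

@[simp] theorem iterDelta_cons (a : A) (l : List A) (Δ : P →ₗ[K] Q) :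
    iterDelta (a :: l) Δ = delta a (iterDelta l Δ) := rfl

/-- Lists in place of tuples make the order condition accessible to induction on the number of
commutators. -/
theorem mem_diffOps_iff {k : ℕ} {Δ : P →ₗ[K] Q} :
    Δ ∈ diffOps K A P Q k ↔ ∀ l : List A, l.length = k + 1 → iterDelta l Δ = 0 := by
  constructor
  · intro h l hl
    have := h (fun i => l.get (i.cast hl.symm))
    rwa [show List.ofFn (fun i : Fin (k + 1) => l.get (i.cast hl.symm)) = l from ?_] at this
    apply List.ext_get
    · simp [hl]
    · intro n h1 h2
      rw [List.get_eq_getElem, List.getElem_ofFn]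
      rfl
  · intro h a
    exact h _ (by simp)

/-- At a "point" `c : A → K` the iterated commutator is, up to sign, the value of the operator on
a product of elements that vanish at the point. -/
theorem map_iterDelta_apply {W : Type*} [AddCommGroup W] [Module K W] (ev : Q →ₗ[K] W)
    (c : A → K) (hc : ∀ a q, ev (a • q) = c a • ev q) (Δ : P →ₗ[K] Q) (l : List A) (p : P) :
    ev (iterDelta l Δ p) =
      (-1 : K) ^ l.length • ev (Δ ((l.map fun a => a - algebraMap K A (c a)).prod • p)) := by
  induction l generalizing p with
  | nil => simp
  | cons a l ih =>
    -- Under `ev`, the factor `a` acts as the scalar `c a`, which moves inside the `K`-linear map;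
    -- each commutator thus contributes a sign and the factor `a - c a`.
    have h1 : ev (iterDelta (a :: l) Δ p) =
        -ev (iterDelta l Δ ((a - algebraMap K A (c a)) • p)) := by
      rw [iterDelta_cons, delta_apply, map_sub, hc, sub_smul, map_sub, map_sub,
        algebraMap_smul A (c a) p, (iterDelta l Δ).map_smul, ev.map_smul]
      abel
    rw [h1, ih, smul_smul, List.map_cons, List.prod_cons, List.length_cons, pow_succ, mul_comm
      ((List.map _ l).prod)]
    simp

end IteratedDelta

/-! ### Taylor's formula with smooth remainder coefficients -/

section Taylor

open MeasureTheory

variable {E : Type*} [NormedAddCommGroup E] [NormedSpace ℝ E] [FiniteDimensional ℝ E]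
  {F : Type*} [NormedAddCommGroup F] [NormedSpace ℝ F] [FiniteDimensional ℝ F]

/-- Differentiation under the integral sign. The weight `p` is arbitrary because each derivative
multiplies it by `t`; the result has the same shape, which drives the induction in
`contDiff_integral_segment`. -/
theorem hasFDerivAt_integral_segment (p : ℝ → ℝ) (hp : Continuous p) {G : E → F}
    (hG : ContDiff ℝ ∞ G) (y₀ y : E) :
    HasFDerivAt (fun y => ∫ t in (0:ℝ)..1, p t • G (y₀ + t • (y - y₀)))
      (∫ t in (0:ℝ)..1, (p t * t) • fderiv ℝ G (y₀ + t • (y - y₀))) y := by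
  have hG' : Continuous (fderiv ℝ G) := hG.continuous_fderiv (by simp)
  have hc : Continuous fun q : E × ℝ => (p q.2 * q.2) • fderiv ℝ G (y₀ + q.2 • (q.1 - y₀)) := by
    fun_prop
  have hGc := hG.continuous
  obtain ⟨C, hC⟩ := ((isCompact_closedBall y 1).prod (isCompact_Icc (a := (0:ℝ)) (b := 1))
    ).exists_bound_of_continuousOn hc.continuousOn
  refine intervalIntegral.hasFDerivAt_integral_of_dominated_of_fderiv_le (bound := fun _ => C)
    (F' := fun y t => (p t * t) • fderiv ℝ G (y₀ + t • (y - y₀)))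
    (Metric.closedBall_mem_nhds y one_pos) ?_ ?_ ?_ ?_ ?_ ?_
  · exact Filter.Eventually.of_forall fun x =>
      (by fun_prop : Continuous fun t => p t • G (y₀ + t • (x - y₀))).aestronglyMeasurable
  · exact (by fun_prop : Continuous fun t => p t • G (y₀ + t • (y - y₀))).intervalIntegrable _ _
  · exact (by fun_prop : Continuous fun t : ℝ =>
      (p t * t) • fderiv ℝ G (y₀ + t • (y - y₀))).aestronglyMeasurable
  · refine Filter.Eventually.of_forall fun t ht x hx => hC (x, t) ⟨hx, ?_⟩
    rw [Set.uIoc_of_le zero_le_one] at ht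
    exact ⟨ht.1.le, ht.2⟩
  · exact intervalIntegrable_const
  · refine Filter.Eventually.of_forall fun t _ x _ => ?_
    have h1 : HasFDerivAt G (fderiv ℝ G (y₀ + t • (x - y₀))) (y₀ + t • (x - y₀)) :=
      (hG.differentiable (by simp) _).hasFDerivAt
    have h2 : HasFDerivAt (fun x : E => y₀ + t • (x - y₀)) (t • ContinuousLinearMap.id ℝ E) x :=
      (((hasFDerivAt_id x).sub_const y₀).const_smul t).const_add y₀
    refine ((h1.comp x h2).const_smul (p t)).congr_fderiv ?_
    rw [ContinuousLinearMap.comp_smul, ContinuousLinearMap.comp_id, smul_smul]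

theorem contDiff_integral_segment (p : ℝ → ℝ) (hp : Continuous p) {G : E → F}
    (hG : ContDiff ℝ ∞ G) (y₀ : E) :
    ContDiff ℝ ∞ (fun y => ∫ t in (0:ℝ)..1, p t • G (y₀ + t • (y - y₀))) := by
  rw [contDiff_infty]
  intro n
  induction n generalizing p G with
  | zero =>
    rw [Nat.cast_zero, contDiff_zero]
    exact (Differentiable.continuous (𝕜 := ℝ) fun y =>
      (hasFDerivAt_integral_segment p hp hG y₀ y).differentiableAt)
  | succ n ih =>
    -- In finite dimension it suffices to treat directional derivatives; these stay `F`-valued, so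
    -- the induction hypothesis applies to them.
    rw [Nat.cast_succ, contDiff_succ_iff_fderiv_apply]
    refine ⟨fun y => (hasFDerivAt_integral_segment p hp hG y₀ y).differentiableAt,
      fun h => by simp at h, fun v => ?_⟩
    have hG' : ContDiff ℝ ∞ (fderiv ℝ G) := hG.fderiv_right (by simp)
    have hGv : ContDiff ℝ ∞ fun y => fderiv ℝ G y v := hG'.clm_apply contDiff_const
    have key := ih (fun t => p t * t) (by fun_prop) hGv
    convert key using 1
    ext y
    rw [(hasFDerivAt_integral_segment p hp hG y₀ y).fderiv]
    have hGc := hG'.continuous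
    rw [ContinuousLinearMap.intervalIntegral_apply]
    · rfl
    · exact (by fun_prop : Continuous fun t : ℝ =>
        (p t * t) • fderiv ℝ G (y₀ + t • (y - y₀))).intervalIntegrable _ _

theorem map_const_eq_sum_basis {ι : Type*} [Fintype ι] (b : Module.Basis ι ℝ E) {n : ℕ}
    (T : E [×n]→L[ℝ] F) (v : E) :
    T (fun _ => v) = ∑ I : Fin n → ι, (∏ j, b.coord (I j) v) • T (fun j => b (I j)) := by
  classical
  conv_lhs => rw [← b.sum_repr v]
  have := T.toMultilinearMap.map_sum (fun (_ : Fin n) (i : ι) => b.repr v i • b i)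
  refine this.trans (Finset.sum_congr rfl fun I _ => ?_)
  exact T.toMultilinearMap.map_smul_univ _ _

/-- Taylor's formula in coordinates, with smooth coefficients in the remainder. -/
theorem exists_taylor_remainder {ι : Type*} [Fintype ι] (b : Module.Basis ι ℝ E) (k : ℕ)
    {g : E → F} (hg : ContDiff ℝ ∞ g) (y₀ : E) :
    ∃ h : (Fin (k + 1) → ι) → E → F, (∀ J, ContDiff ℝ ∞ (h J)) ∧ ∀ y,
      g y = ∑ i : Fin (k + 1), ((i : ℕ).factorial : ℝ)⁻¹ • ∑ I : Fin (i : ℕ) → ι,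
          (∏ j, b.coord (I j) (y - y₀)) • iteratedFDeriv ℝ i g y₀ (fun j => b (I j)) +
        ∑ J : Fin (k + 1) → ι, (∏ j, b.coord (J j) (y - y₀)) • h J y := by
  have hG : ∀ J : Fin (k + 1) → ι,
      ContDiff ℝ ∞ fun y => iteratedFDeriv ℝ (k + 1) g y (fun j => b (J j)) := fun J => by
    have h1 : ContDiff ℝ ∞ (iteratedFDeriv ℝ (k + 1) g) :=
      hg.iteratedFDeriv_right (by norm_cast)
    exact ((ContinuousMultilinearMap.apply ℝ (fun _ : Fin (k + 1) => E) F
      (fun j => b (J j))).contDiff).comp h1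
  -- The witnesses are the components, in the basis `b`, of the integral remainder of order `k + 1`.
  -- Multi-indices are ordered tuples, so no multinomial coefficients occur.
  refine ⟨fun J y => (k.factorial : ℝ)⁻¹ • ∫ t in (0:ℝ)..1, (1 - t) ^ k •
    iteratedFDeriv ℝ (k + 1) g (y₀ + t • (y - y₀)) (fun j => b (J j)), fun J => ?_, fun y => ?_⟩
  · exact (contDiff_integral_segment (fun t => (1 - t) ^ k) (by fun_prop) (hG J) y₀).const_smul _
  · have key := map_add_eq_sum_add_integral_iteratedFDeriv (f := g) (x := y₀) (y := y - y₀) (n := k)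
      (fun t _ => (hg.of_le (by exact_mod_cast le_top)).contDiffAt)
    rw [add_sub_cancel] at key
    rw [key]
    congr 1
    · rw [Finset.sum_range]
      exact Finset.sum_congr rfl fun i _ => by rw [map_const_eq_sum_basis b]
    · simp_rw [smul_comm _ (k.factorial : ℝ)⁻¹]
      rw [← Finset.smul_sum]
      congr 1
      simp_rw [← intervalIntegral.integral_smul]
      rw [← intervalIntegral.integral_finsetSum]
      · refine intervalIntegral.integral_congr fun t _ => ?_
        rw [map_const_eq_sum_basis b, Finset.smul_sum]
        exact Finset.sum_congr rfl fun J _ => smul_comm _ _ _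
      · intro J _
        have := (hG J).continuous
        exact (by fun_prop : Continuous fun t : ℝ => (∏ j, b.coord (J j) (y - y₀)) • (1 - t) ^ k •
          iteratedFDeriv ℝ (k + 1) g (y₀ + t • (y - y₀)) (fun j => b (J j))).intervalIntegrable _ _

end Taylor

/-! ### Cutoffs, extension by zero, and locality of differential operators -/

section Manifold

variable {E : Type*} [NormedAddCommGroup E] [NormedSpace ℝ E]
  {X : Type*} [TopologicalSpace X] [ChartedSpace E X] [IsManifold 𝓘(ℝ, E) ∞ X]
  {F : Type*} [NormedAddCommGroup F] [NormedSpace ℝ F]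
  {V : X → Type*} [TopologicalSpace (Bundle.TotalSpace F V)]
  [∀ x, AddCommGroup (V x)] [∀ x, Module ℝ (V x)] [∀ x, TopologicalSpace (V x)]
  [FiberBundle F V] [VectorBundle ℝ F V] [ContMDiffVectorBundle ∞ F V 𝓘(ℝ, E)]

open Filter Topology

variable (E F V) in
theorem isOpen_localDomain (x₀ : X) : IsOpen (localDomain E F V x₀) :=
  (chartAt E x₀).open_source.inter (trivializationAt F V x₀).open_baseSet

variable (E F V) in
/-- The fibre coordinate `V x → F` of the trivialization at `x₀`. -/
def fiberCoord (x₀ x : X) : V x →ₗ[ℝ] F := (trivializationAt F V x₀).linearMapAt ℝ x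

theorem fiberCoord_apply {x₀ x : X} (hx : x ∈ localDomain E F V x₀) (v : V x) :
    fiberCoord F V x₀ x v = (trivializationAt F V x₀ ⟨x, v⟩).2 := by
  rw [fiberCoord, Bundle.Trivialization.coe_linearMapAt_of_mem _ hx.2]

theorem fiberCoord_injective {x₀ x : X} (hx : x ∈ localDomain E F V x₀) :
    Function.Injective (fiberCoord F V x₀ x) := by
  intro v w h
  have h1 := (trivializationAt F V x₀).symm_linearMapAt (R := ℝ) hx.2
  rw [← h1 v, ← h1 w]
  exact congrArg _ h

theorem localRep_chartAt {x₀ x : X} (hx : x ∈ localDomain E F V x₀) (s : Sections E F V) :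
    localRep x₀ s (chartAt E x₀ x) = fiberCoord F V x₀ x (s x) := by
  rw [fiberCoord_apply hx, localRep, (chartAt E x₀).left_inv hx.1]

/-- The local expression of a section only depends on the germ of the section. -/
theorem localRep_congr {x₀ x : X} (hx : x ∈ localDomain E F V x₀) {s t : Sections E F V}
    (h : ∀ᶠ y in 𝓝 x, s y = t y) :
    localRep x₀ s =ᶠ[𝓝 (chartAt E x₀ x)] localRep x₀ t := by
  have hc : Tendsto (chartAt E x₀).symm (𝓝 (chartAt E x₀ x)) (𝓝 x) := by
    have := (chartAt E x₀).tendsto_symm hx.1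
    exact this
  filter_upwards [hc.eventually h] with y hy
  rw [localRep, localRep, hy]

theorem localDeriv_congr {x₀ x : X} (hx : x ∈ localDomain E F V x₀) {s t : Sections E F V}
    (h : ∀ᶠ y in 𝓝 x, s y = t y) (n : ℕ) : localDeriv x₀ n x s = localDeriv x₀ n x t :=
  ((localRep_congr hx h).iteratedFDeriv ℝ n).eq_of_nhds

/-- A smooth function with compact support in the domain of the chart and the trivialization
at `x₀`. -/
structure Cutoff (E : Type*) [NormedAddCommGroup E] [NormedSpace ℝ E]
    {X : Type*} [TopologicalSpace X] [ChartedSpace E X]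
    (F : Type*) [NormedAddCommGroup F] [NormedSpace ℝ F]
    (V : X → Type*) [TopologicalSpace (Bundle.TotalSpace F V)] [∀ x, TopologicalSpace (V x)]
    [FiberBundle F V] (x₀ : X) where
  /-- the function -/
  fn : SmoothFun E X
  hasCompactSupport : HasCompactSupport fn
  tsupport_subset : tsupport fn ⊆ localDomain E F V x₀

variable (E) in
theorem exists_bump [FiniteDimensional ℝ E] [T2Space X] {x : X} {U : Set X} (hU : U ∈ 𝓝 x) :
    ∃ χ : SmoothFun E X, HasCompactSupport χ ∧ tsupport χ ⊆ U ∧ ∀ᶠ y in 𝓝 x, χ y = 1 := by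
  obtain ⟨f, -, hf⟩ := (SmoothBumpFunction.nhds_basis_tsupport (I := 𝓘(ℝ, E)) x).mem_iff.1 hU
  exact ⟨⟨f, f.contMDiff⟩, f.hasCompactSupport, hf, f.eventuallyEq_one⟩

theorem exists_cutoff [FiniteDimensional ℝ E] [T2Space X] {x₀ x : X}
    (hx : x ∈ localDomain E F V x₀) : ∃ χ : Cutoff E F V x₀, ∀ᶠ y in 𝓝 x, χ.fn y = 1 := by
  obtain ⟨χ, h1, h2, h3⟩ := exists_bump E ((isOpen_localDomain E F V x₀).mem_nhds hx)
  exact ⟨⟨χ, h1, h2⟩, h3⟩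

theorem contMDiffAt_comp_chart {G : Type*} [NormedAddCommGroup G] [NormedSpace ℝ G] {x₀ x : X}
    (hx : x ∈ (chartAt E x₀).source) {h : E → G} (hh : ContDiffAt ℝ ∞ h (chartAt E x₀ x)) :
    ContMDiffAt 𝓘(ℝ, E) 𝓘(ℝ, G) ∞ (fun y => h (chartAt E x₀ y)) x :=
  hh.contMDiffAt.comp x ((contMDiffOn_chart (I := 𝓘(ℝ, E)) (n := ∞) (x := x₀)).contMDiffAt
    ((chartAt E x₀).open_source.mem_nhds hx))

namespace Cutoff

variable {x₀ : X} (χ : Cutoff E F V x₀)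

theorem eventually_zero {x : X} (hx : x ∉ localDomain E F V x₀) : ∀ᶠ y in 𝓝 x, χ.fn y = 0 := by
  have h := notMem_tsupport_iff_eventuallyEq.1 fun h => hx (χ.tsupport_subset h)
  exact h

/-- The global function that is given by `χ • h` in the chart at `x₀`. -/
def extFun {h : E → ℝ} (hh : ContDiff ℝ ∞ h) : SmoothFun E X where
  val x := χ.fn x * h (chartAt E x₀ x)
  property x := by
    -- Off the local domain the point is outside the support of the cutoff, so the function is zero
    -- nearby; the junk values of the chart play no role.
    by_cases hx : x ∈ localDomain E F V x₀
    · exact χ.fn.contMDiff.contMDiffAt.mul (contMDiffAt_comp_chart hx.1 hh.contDiffAt)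
    · refine (contMDiffAt_const (c := (0 : ℝ))).congr_of_eventuallyEq ?_
      filter_upwards [χ.eventually_zero hx] with y hy
      rw [hy, zero_mul]

/-- The global section that is given by `χ • h` in the chart and the trivialization at `x₀`. -/
def extSection {h : E → F} (hh : ContDiff ℝ ∞ h) : Sections E F V where
  toFun x := χ.fn x • (trivializationAt F V x₀).symmₗ ℝ x (h (chartAt E x₀ x))
  contMDiff_toFun x := by
    by_cases hx : x ∈ localDomain E F V x₀
    · rw [(trivializationAt F V x₀).contMDiffAt_section_iff hx.2]
      refine (χ.fn.contMDiff.contMDiffAt.smul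
        (contMDiffAt_comp_chart hx.1 hh.contDiffAt)).congr_of_eventuallyEq ?_
      filter_upwards [(isOpen_localDomain E F V x₀).mem_nhds hx] with y hy
      rw [← fiberCoord_apply hy, map_smul, fiberCoord,
        Bundle.Trivialization.linearMapAt_symmₗ _ hy.2]
      rfl
    · refine (Bundle.contMDiff_zeroSection ℝ V x).congr_of_eventuallyEq ?_
      filter_upwards [χ.eventually_zero hx] with y hy
      rw [hy, zero_smul]
      rfl

theorem extSection_apply {h : E → F} (hh : ContDiff ℝ ∞ h) (x : X) :
    χ.extSection hh x = χ.fn x • (trivializationAt F V x₀).symmₗ ℝ x (h (chartAt E x₀ x)) := rfl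

theorem fiberCoord_extSection {h : E → F} (hh : ContDiff ℝ ∞ h) {x : X}
    (hx : x ∈ localDomain E F V x₀) :
    fiberCoord F V x₀ x (χ.extSection hh x) = χ.fn x • h (chartAt E x₀ x) := by
  rw [extSection_apply, map_smul, fiberCoord, Bundle.Trivialization.linearMapAt_symmₗ _ hx.2]

theorem smul_mem_testSections (s : Sections E F V) : χ.fn • s ∈ testSections E F V := by
  refine IsCompact.of_isClosed_subset χ.hasCompactSupport isClosed_closure (closure_mono ?_)
  intro x hx h
  refine hx ?_
  rw [sections_smul_apply, h, zero_smul]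

theorem extSection_mem_testSections {h : E → F} (hh : ContDiff ℝ ∞ h) :
    χ.extSection hh ∈ testSections E F V := by
  refine IsCompact.of_isClosed_subset χ.hasCompactSupport isClosed_closure (closure_mono ?_)
  intro x hx h
  refine hx ?_
  rw [extSection_apply, h, zero_smul]

/-- The test section that is given by `χ • h` in the chart and the trivialization at `x₀`. -/
def extTest {h : E → F} (hh : ContDiff ℝ ∞ h) : testSections E F V :=
  ⟨χ.extSection hh, χ.extSection_mem_testSections hh⟩

/-- The test section `χ • s`. -/
def mulTest : Sections E F V →ₗ[ℝ] testSections E F V where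
  toFun s := ⟨χ.fn • s, χ.smul_mem_testSections s⟩
  map_add' s t := Subtype.ext (smul_add χ.fn s t)
  map_smul' c s := Subtype.ext (smul_comm χ.fn c s)

theorem mulTest_apply (s : Sections E F V) (x : X) : (χ.mulTest s).1 x = χ.fn x • s x := rfl

end Cutoff

/-- A section that vanishes near `x` is a multiple of itself by a function vanishing at `x`. -/
theorem exists_smul_eq_self [FiniteDimensional ℝ E] [T2Space X] {x : X} {s : Sections E F V}
    (hs : ∀ᶠ y in 𝓝 x, s y = 0) : ∃ f : SmoothFun E X, f x = 0 ∧ f • s = s := by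
  -- The bump `χ` is supported where `s` vanishes, so `1 - χ` equals 1 wherever `s` is nonzero, and
  -- it vanishes at `x`.
  obtain ⟨χ, -, h2, h3⟩ := exists_bump E hs
  refine ⟨1 - χ, ?_, ?_⟩
  · change 1 - χ x = 0
    rw [h3.self_of_nhds, sub_self]
  · ext y
    change (1 - χ y) • s y = s y
    by_cases hy : y ∈ tsupport χ
    · have h0 : s y = 0 := h2 hy
      rw [h0, smul_zero]
    · rw [image_eq_zero_of_notMem_tsupport hy, sub_zero, one_smul]

theorem eventually_zero_of_notMem_support {s : Sections E F V} {x : X}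
    (hx : x ∉ sectionSupport s) : ∀ᶠ y in 𝓝 x, s y = 0 := by
  filter_upwards [isClosed_closure.isOpen_compl.mem_nhds hx] with y hy
  by_contra h
  exact hy (subset_closure h)

variable (E F V) in
/-- Evaluation of test sections at a point. -/
def evalAt (x : X) : testSections E F V →ₗ[ℝ] V x where
  toFun s := s.1 x
  map_add' _ _ := rfl
  map_smul' _ _ := rfl

@[simp] theorem evalAt_apply (x : X) (s : testSections E F V) : evalAt E F V x s = s.1 x := rfl

theorem evalAt_smul (x : X) (f : SmoothFun E X) (s : testSections E F V) :
    evalAt E F V x (f • s) = f x • evalAt E F V x s := rfl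

/-- The product of the functions `a - a(x)` for `a` in a list. -/
def centeredProd (x : X) (l : List (SmoothFun E X)) : SmoothFun E X :=
  (l.map fun a => a - algebraMap ℝ (SmoothFun E X) (a x)).prod

theorem centeredProd_apply (x : X) (l : List (SmoothFun E X)) (y : X) :
    centeredProd x l y = (l.map fun a => a y - a x).prod := by
  induction l with
  | nil => rfl
  | cons a l ih =>
    rw [centeredProd, List.map_cons, List.prod_cons, List.map_cons, List.prod_cons, ← ih]
    rfl

theorem iterDelta_apply_apply (D : testSections E F V →ₗ[ℝ] testSections E F V)
    (l : List (SmoothFun E X)) (s : testSections E F V) (x : X) :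
    (iterDelta l D s).1 x = (-1 : ℝ) ^ l.length • (D (centeredProd x l • s)).1 x := by
  have h := map_iterDelta_apply (evalAt E F V x) (fun a : SmoothFun E X => a x)
    (evalAt_smul x) D l s
  rw [evalAt_apply, evalAt_apply] at h
  exact h

/-- The working form of the order condition: the iterated commutator is zero, and the sign relating
it to this value is invertible. -/
theorem diffOps_centeredProd_smul {k : ℕ} {D : testSections E F V →ₗ[ℝ] testSections E F V}
    (hD : D ∈ diffOps ℝ (SmoothFun E X) (testSections E F V) (testSections E F V) k)
    {l : List (SmoothFun E X)} (hl : l.length = k + 1) (s : testSections E F V) (x : X) :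
    (D (centeredProd x l • s)).1 x = 0 := by
  have h := iterDelta_apply_apply D l s x
  rw [mem_diffOps_iff.1 hD l hl] at h
  have h2 : (0 : V x) = (-1 : ℝ) ^ l.length • (D (centeredProd x l • s)).1 x := h
  rw [eq_comm, smul_eq_zero] at h2
  exact h2.resolve_left (pow_ne_zero _ (by norm_num))

/-- A differential operator does not enlarge supports. -/
theorem diffOps_apply_eq_zero [FiniteDimensional ℝ E] [T2Space X] {k : ℕ}
    {D : testSections E F V →ₗ[ℝ] testSections E F V}
    (hD : D ∈ diffOps ℝ (SmoothFun E X) (testSections E F V) (testSections E F V) k)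
    {s : testSections E F V} {x : X} (hs : ∀ᶠ y in 𝓝 x, s.1 y = 0) : (D s).1 x = 0 := by
  obtain ⟨f, hf0, hf⟩ := exists_smul_eq_self hs
  -- From `f • s = s` with `f x = 0`, the section is a multiple of arbitrarily many functions
  -- vanishing at `x`; `k + 1` of them suffice.
  have key : ∀ n, centeredProd x (List.replicate n f) • s = s := by
    intro n
    induction n with
    | zero => exact one_smul _ s
    | succ n ih =>
      have : centeredProd x (List.replicate (n + 1) f) =
          f * centeredProd x (List.replicate n f) := by
        rw [List.replicate_succ, centeredProd, List.map_cons, List.prod_cons, hf0, map_zero,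
          sub_zero]
        rfl
      rw [this, mul_smul, ih]
      exact Subtype.ext hf
  rw [← key (k + 1)]
  exact diffOps_centeredProd_smul hD (by simp) s x

theorem diffOps_apply_congr [FiniteDimensional ℝ E] [T2Space X] {k : ℕ}
    {D : testSections E F V →ₗ[ℝ] testSections E F V}
    (hD : D ∈ diffOps ℝ (SmoothFun E X) (testSections E F V) (testSections E F V) k)
    {s t : testSections E F V} {x : X} (hs : ∀ᶠ y in 𝓝 x, s.1 y = t.1 y) :
    (D s).1 x = (D t).1 x := by
  have h : (D (s - t)).1 x = 0 := diffOps_apply_eq_zero hD (by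
    filter_upwards [hs] with y hy
    exact sub_eq_zero.2 hy)
  rw [map_sub] at h
  exact sub_eq_zero.1 h

end Manifold

/-! ### Finite-dimensional spaces of jet components -/

section FiniteDim

/-- Gives finite dimension of `JetCoord`, so that linear maps on it are continuous, and local
compactness of the spaces of derivatives. -/
instance finiteDimensional_continuousMultilinearMap {ι : Type*} [Finite ι] {E F : Type*}
    [NormedAddCommGroup E] [NormedSpace ℝ E] [FiniteDimensional ℝ E]
    [NormedAddCommGroup F] [NormedSpace ℝ F] [FiniteDimensional ℝ F] :
    FiniteDimensional ℝ (ContinuousMultilinearMap ℝ (fun _ : ι => E) F) :=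
  FiniteDimensional.of_injective
    ({ toFun := ContinuousMultilinearMap.toMultilinearMap
       map_add' := fun _ _ => rfl
       map_smul' := fun _ _ => rfl } :
      ContinuousMultilinearMap ℝ (fun _ : ι => E) F →ₗ[ℝ] MultilinearMap ℝ (fun _ : ι => E) F)
    ContinuousMultilinearMap.toMultilinearMap_injective

/-- Smoothness of a family of linear maps on a finite-dimensional space is pointwise smoothness. -/
theorem contMDiffAt_clm_of_apply {E : Type*} [NormedAddCommGroup E] [NormedSpace ℝ E]
    {X : Type*} [TopologicalSpace X] [ChartedSpace E X]
    {W F : Type*} [NormedAddCommGroup W] [NormedSpace ℝ W] [FiniteDimensional ℝ W]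
    [NormedAddCommGroup F] [NormedSpace ℝ F] {f : X → W →L[ℝ] F} {x : X}
    (h : ∀ w, ContMDiffAt 𝓘(ℝ, E) 𝓘(ℝ, F) ∞ (fun y => f y w) x) :
    ContMDiffAt 𝓘(ℝ, E) 𝓘(ℝ, W →L[ℝ] F) ∞ f x := by
  classical
  let b := Module.finBasis ℝ W
  have hf : f = fun y => ∑ j, ContinuousLinearMap.smulRightL ℝ W F
      (LinearMap.toContinuousLinearMap (b.coord j)) (f y (b j)) := by
    ext y w
    rw [sum_apply]
    conv_lhs => rw [← b.sum_repr w, map_sum]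
    exact Finset.sum_congr rfl fun j _ => by rw [map_smul]; rfl
  rw [hf]
  refine contMDiffAt_finsetSum fun j _ => ?_
  exact (ContinuousLinearMap.contDiff _).contMDiff.contMDiffAt.comp x (h (b j))

end FiniteDim

/-! ### Taylor polynomials of sections and the coefficients of an operator -/

section Manifold

variable {E : Type*} [NormedAddCommGroup E] [NormedSpace ℝ E]
  {X : Type*} [TopologicalSpace X] [ChartedSpace E X] [IsManifold 𝓘(ℝ, E) ∞ X]
  {F : Type*} [NormedAddCommGroup F] [NormedSpace ℝ F]
  {V : X → Type*} [TopologicalSpace (Bundle.TotalSpace F V)]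
  [∀ x, AddCommGroup (V x)] [∀ x, Module ℝ (V x)] [∀ x, TopologicalSpace (V x)]
  [FiberBundle F V] [VectorBundle ℝ F V] [ContMDiffVectorBundle ∞ F V 𝓘(ℝ, E)]

variable [FiniteDimensional ℝ E] [T2Space X] [FiniteDimensional ℝ F]

open Filter Topology

variable (E F) in
/-- The components of `k`-jets in coordinates. -/
abbrev JetCoord (k : ℕ) : Type _ := (i : Fin (k + 1)) → E [×(i : ℕ)]→L[ℝ] F

theorem contMDiffOn_fiberCoord (x₀ : X) (s : Sections E F V) :
    ContMDiffOn 𝓘(ℝ, E) 𝓘(ℝ, F) ∞ (fun x => fiberCoord F V x₀ x (s x)) (localDomain E F V x₀) := by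
  have h := ((trivializationAt F V x₀).contMDiffOn_section_baseSet_iff
    (IB := 𝓘(ℝ, E)) (n := ∞) (s := s)).1 s.contMDiff.contMDiffOn
  exact (h.mono Set.inter_subset_right).congr fun x hx => fiberCoord_apply hx _

namespace Cutoff

variable {x₀ : X} (χ : Cutoff E F V x₀)

/-- The coordinate functions of the chart at `x₀`, cut off. -/
def coord (i : Fin (Module.finrank ℝ E)) : SmoothFun E X :=
  χ.extFun (h := (Module.finBasis ℝ E).coord i)
    (LinearMap.toContinuousLinearMap ((Module.finBasis ℝ E).coord i)).contDiff

/-- The constant sections in the trivialization at `x₀`, cut off. -/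
def constTest : F →ₗ[ℝ] testSections E F V where
  toFun v := χ.extTest (h := fun _ => v) contDiff_const
  map_add' v w := Subtype.ext <| ContMDiffSection.ext fun x => by
    refine (?_ : χ.extSection (h := fun _ => v + w) contDiff_const x =
      χ.extSection (h := fun _ => v) contDiff_const x +
        χ.extSection (h := fun _ => w) contDiff_const x)
    simp only [extSection_apply, map_add, smul_add]
  map_smul' c v := Subtype.ext <| ContMDiffSection.ext fun x => by
    refine (?_ : χ.extSection (h := fun _ => c • v) contDiff_const x =
      c • χ.extSection (h := fun _ => v) contDiff_const x)
    simp only [extSection_apply, map_smul]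
    rw [smul_comm]

/-- The product of the centered coordinate functions of the chart at `x₀` that belong to a
multi-index. -/
def monomial (x : X) {n : ℕ} (I : Fin n → Fin (Module.finrank ℝ E)) : SmoothFun E X :=
  centeredProd x (List.ofFn fun j => χ.coord (I j))

/-- The factors are cut-off coordinates centred at `x`, so they agree with the true ones only if the
cutoff is 1 both at the centre `x` and at `y`. -/
theorem monomial_apply {x y : X} (hx : χ.fn x = 1) (hy : χ.fn y = 1) {n : ℕ}
    (I : Fin n → Fin (Module.finrank ℝ E)) :
    χ.monomial x I y =
      ∏ j, (Module.finBasis ℝ E).coord (I j) (chartAt E x₀ y - chartAt E x₀ x) := by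
  rw [monomial, centeredProd_apply, List.map_ofFn, List.prod_ofFn]
  refine Finset.prod_congr rfl fun j _ => ?_
  change χ.fn y * _ - χ.fn x * _ = _
  rw [hx, hy, one_mul, one_mul, map_sub]

/-- The test section that is a Taylor polynomial at `x` with the given derivatives. -/
def taylorTest {k : ℕ} (x : X) : JetCoord E F k →ₗ[ℝ] testSections E F V :=
  ∑ i : Fin (k + 1), ((i : ℕ).factorial : ℝ)⁻¹ • ∑ I : Fin (i : ℕ) → Fin (Module.finrank ℝ E),
    Algebra.lsmul ℝ ℝ (testSections E F V) (χ.monomial x I) ∘ₗ χ.constTest ∘ₗ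
      (ContinuousMultilinearMap.apply ℝ (fun _ : Fin (i : ℕ) => E) F
        (fun j => Module.finBasis ℝ E (I j))).toLinearMap ∘ₗ LinearMap.proj i

theorem taylorTest_apply {k : ℕ} (x : X) (T : JetCoord E F k) :
    χ.taylorTest x T = ∑ i : Fin (k + 1), ((i : ℕ).factorial : ℝ)⁻¹ •
      ∑ I : Fin (i : ℕ) → Fin (Module.finrank ℝ E),
        χ.monomial x I • χ.constTest (T i fun j => Module.finBasis ℝ E (I j)) := by
  rw [taylorTest, LinearMap.sum_apply]
  refine Finset.sum_congr rfl fun i _ => ?_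
  rw [LinearMap.smul_apply, LinearMap.sum_apply]
  rfl

theorem fiberCoord_taylorTest {k : ℕ} {x y : X} (hx : χ.fn x = 1) (hy : χ.fn y = 1)
    (hyd : y ∈ localDomain E F V x₀) (T : JetCoord E F k) :
    fiberCoord F V x₀ y ((χ.taylorTest x T).1 y) =
      ∑ i : Fin (k + 1), ((i : ℕ).factorial : ℝ)⁻¹ •
        ∑ I : Fin (i : ℕ) → Fin (Module.finrank ℝ E),
          (∏ j, (Module.finBasis ℝ E).coord (I j) (chartAt E x₀ y - chartAt E x₀ x)) •
            T i fun j => Module.finBasis ℝ E (I j) := by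
  rw [taylorTest_apply, ← evalAt_apply, map_sum, map_sum]
  refine Finset.sum_congr rfl fun i _ => ?_
  rw [map_smul, map_smul, map_sum, map_sum]
  congr 1
  refine Finset.sum_congr rfl fun I _ => ?_
  rw [evalAt_smul, map_smul, monomial_apply χ hx hy]
  congr 1
  refine (χ.fiberCoord_extSection contDiff_const hyd).trans ?_
  rw [hy, one_smul]

end Cutoff

/-- Taylor's formula for sections: near `x`, a section is the sum of its Taylor polynomial and of
multiples of products of `k + 1` functions that vanish at `x`. -/
theorem exists_taylor_section {x₀ x : X} (hx : x ∈ localDomain E F V x₀) (χ : Cutoff E F V x₀)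
    (hχ : ∀ᶠ y in 𝓝 x, χ.fn y = 1) (k : ℕ) (s : Sections E F V) :
    ∃ t : (Fin (k + 1) → Fin (Module.finrank ℝ E)) → testSections E F V,
      ∀ᶠ y in 𝓝 x, s y = (χ.taylorTest x (fun i : Fin (k + 1) => localDeriv x₀ i x s) +
        ∑ J, χ.monomial x J • t J).1 y := by
  set y₀ := chartAt E x₀ x with hy₀
  have hU := isOpen_localTarget E F V x₀
  have hm : y₀ ∈ localTarget E F V x₀ := mem_localTarget E F V hx
  obtain ⟨r, hr, hrU⟩ := Metric.nhds_basis_closedBall.mem_iff.1 (hU.mem_nhds hm)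
  -- The local expression is smooth only on `localTarget`. Multiplication by `ρ`, supported there,
  -- makes it smooth on all of `E`, as `exists_taylor_remainder` demands, without changing its germ
  -- at `y₀`.
  let ρ : ContDiffBump y₀ := ⟨r / 2, r, by positivity, by linarith⟩
  have hg : ContDiff ℝ ∞ fun y => ρ y • localRep x₀ s y := by
    rw [contDiff_iff_contDiffAt]
    intro y
    by_cases hy : y ∈ localTarget E F V x₀
    · exact ρ.contDiffAt.smul ((contDiffOn_localRep E F V x₀ s).contDiffAt (hU.mem_nhds hy))
    · refine (contDiffAt_const (c := (0 : F))).congr_of_eventuallyEq ?_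
      have h1 : y ∉ tsupport ρ := fun h => hy (hrU (ρ.tsupport_eq ▸ h))
      filter_upwards [notMem_tsupport_iff_eventuallyEq.1 h1] with z hz
      rw [hz, Pi.zero_apply, zero_smul]
  obtain ⟨h, hh, heq⟩ := exists_taylor_remainder (Module.finBasis ℝ E) k hg y₀
  have hge : (fun y => ρ y • localRep x₀ s y) =ᶠ[𝓝 y₀] localRep x₀ s := by
    filter_upwards [ρ.eventuallyEq_one] with y hy
    rw [hy, Pi.one_apply, one_smul]
  refine ⟨fun J => χ.extTest (hh J), ?_⟩
  have hcont : Tendsto (chartAt E x₀) (𝓝 x) (𝓝 y₀) := (chartAt E x₀).continuousAt hx.1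
  filter_upwards [hχ, (isOpen_localDomain E F V x₀).mem_nhds hx, hcont.eventually hge]
    with y hy hyd hgy
  apply fiberCoord_injective hyd
  rw [← localRep_chartAt hyd, ← hgy, heq, ← evalAt_apply, map_add, map_add, evalAt_apply,
    χ.fiberCoord_taylorTest hχ.self_of_nhds hy hyd]
  congr 1
  · refine Finset.sum_congr rfl fun i _ => ?_
    congr 1
    refine Finset.sum_congr rfl fun I _ => ?_
    rw [(hge.iteratedFDeriv ℝ i).eq_of_nhds]
    rfl
  · rw [map_sum, map_sum]
    refine Finset.sum_congr rfl fun J _ => ?_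
    rw [evalAt_smul, map_smul, χ.monomial_apply hχ.self_of_nhds hy]
    congr 1
    refine Eq.trans ?_ (χ.fiberCoord_extSection (hh J) hyd).symm
    rw [hy, one_smul]

section Coefficients

/-- The value at `x` of a differential operator on Taylor polynomials at `x`, in coordinates. -/
def coefficient {k : ℕ} (D : testSections E F V →ₗ[ℝ] testSections E F V) {x₀ : X}
    (χ : Cutoff E F V x₀) (x : X) : JetCoord E F k →L[ℝ] F :=
  LinearMap.toContinuousLinearMap
    (fiberCoord F V x₀ x ∘ₗ evalAt E F V x ∘ₗ D ∘ₗ χ.taylorTest x)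

theorem coefficient_apply {k : ℕ} (D : testSections E F V →ₗ[ℝ] testSections E F V) {x₀ : X}
    (χ : Cutoff E F V x₀) (x : X) (T : JetCoord E F k) :
    coefficient D χ x T = fiberCoord F V x₀ x ((D (χ.taylorTest x T)).1 x) := rfl

/-- The Taylor monomials are `centeredProd`s, so `iterDelta_apply_apply` converts the value of `D`
on a Taylor polynomial centred at `x` into values at `x` of iterated commutators applied to cut-off
constant sections. Those sections do not depend on `x`, which is why the coefficients are smooth;
the sign powers cancel. -/
theorem coefficient_eq {k : ℕ} (D : testSections E F V →ₗ[ℝ] testSections E F V) {x₀ : X}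
    (χ : Cutoff E F V x₀) (x : X) (T : JetCoord E F k) :
    coefficient D χ x T = ∑ i : Fin (k + 1), ((i : ℕ).factorial : ℝ)⁻¹ •
      ∑ I : Fin (i : ℕ) → Fin (Module.finrank ℝ E), (-1 : ℝ) ^ (i : ℕ) • fiberCoord F V x₀ x
        ((iterDelta (List.ofFn fun j => χ.coord (I j)) D
          (χ.constTest (T i fun j => Module.finBasis ℝ E (I j)))).1 x) := by
  rw [coefficient_apply, Cutoff.taylorTest_apply, map_sum, ← evalAt_apply, map_sum, map_sum]
  refine Finset.sum_congr rfl fun i _ => ?_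
  rw [D.map_smul, map_smul, map_smul, map_sum, map_sum, map_sum]
  congr 1
  refine Finset.sum_congr rfl fun I _ => ?_
  rw [iterDelta_apply_apply, (fiberCoord F V x₀ x).map_smul, smul_smul, List.length_ofFn, ← mul_pow, evalAt_apply]
  norm_num
  rfl

theorem contMDiffOn_coefficient {k : ℕ} (D : testSections E F V →ₗ[ℝ] testSections E F V) {x₀ : X}
    (χ : Cutoff E F V x₀) :
    ContMDiffOn 𝓘(ℝ, E) 𝓘(ℝ, JetCoord E F k →L[ℝ] F) ∞ (coefficient (k := k) D χ)
      (localDomain E F V x₀) := by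
  intro x hx
  refine (contMDiffAt_clm_of_apply fun T => ?_).contMDiffWithinAt
  simp_rw [coefficient_eq]
  refine contMDiffAt_finsetSum fun i _ => ?_
  refine (contMDiffAt_const (I' := 𝓘(ℝ, ℝ))).smul (contMDiffAt_finsetSum fun I _ =>
    (contMDiffAt_const (I' := 𝓘(ℝ, ℝ))).smul ?_)
  exact (contMDiffOn_fiberCoord x₀ _).contMDiffAt ((isOpen_localDomain E F V x₀).mem_nhds hx)

variable {k : ℕ} {D : testSections E F V →ₗ[ℝ] testSections E F V}

/-- The Taylor sections built from the two cutoffs have the same germ at `x`, and `D` is local. This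
lets coefficients built from different cutoffs be glued. -/
theorem coefficient_congr
    (hD : D ∈ diffOps ℝ (SmoothFun E X) (testSections E F V) (testSections E F V) k)
    {x₀ x : X} (hx : x ∈ localDomain E F V x₀) {χ χ' : Cutoff E F V x₀}
    (hχ : ∀ᶠ y in 𝓝 x, χ.fn y = 1) (hχ' : ∀ᶠ y in 𝓝 x, χ'.fn y = 1) :
    coefficient (k := k) D χ x = coefficient D χ' x := by
  ext T
  rw [coefficient_apply, coefficient_apply]
  congr 1
  refine diffOps_apply_congr hD ?_
  filter_upwards [hχ, hχ', (isOpen_localDomain E F V x₀).mem_nhds hx] with y h1 h2 hy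
  apply fiberCoord_injective hy
  rw [χ.fiberCoord_taylorTest hχ.self_of_nhds h1 hy,
    χ'.fiberCoord_taylorTest hχ'.self_of_nhds h2 hy]

/-- Near `x`, `s` is its Taylor polynomial plus multiples of products of `k + 1` functions vanishing
at `x`; `D` kills the latter at `x`, so only the polynomial contributes. -/
theorem fiberCoord_diffOps_apply
    (hD : D ∈ diffOps ℝ (SmoothFun E X) (testSections E F V) (testSections E F V) k)
    {x₀ x : X} (hx : x ∈ localDomain E F V x₀) {χ : Cutoff E F V x₀}
    (hχ : ∀ᶠ y in 𝓝 x, χ.fn y = 1) (s : testSections E F V) :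
    fiberCoord F V x₀ x ((D s).1 x) =
      coefficient D χ x fun i : Fin (k + 1) => localDeriv x₀ i x s.1 := by
  obtain ⟨t, ht⟩ := exists_taylor_section hx χ hχ k s.1
  rw [diffOps_apply_congr hD ht, coefficient_apply, map_add, map_sum, ← evalAt_apply, map_add,
    map_sum, Finset.sum_eq_zero, add_zero, evalAt_apply]
  intro J _
  exact diffOps_centeredProd_smul hD (by simp) _ _

/-- A differential operator of order `k` is given in coordinates by smooth coefficients. -/
theorem exists_coefficients
    (hD : D ∈ diffOps ℝ (SmoothFun E X) (testSections E F V) (testSections E F V) k) (x₀ : X) :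
    ∃ a : X → JetCoord E F k →L[ℝ] F,
      ContMDiffOn 𝓘(ℝ, E) 𝓘(ℝ, JetCoord E F k →L[ℝ] F) ∞ a (localDomain E F V x₀) ∧
      ∀ x ∈ localDomain E F V x₀, ∀ s : testSections E F V,
        fiberCoord F V x₀ x ((D s).1 x) = a x fun i => localDeriv x₀ i x s.1 := by
  classical
  choose χ hχ using fun x : localDomain E F V x₀ => exists_cutoff x.2
  -- A compactly supported cutoff need not be 1 on the whole local domain, so each point uses its
  -- own. Near `x` all of them give the same coefficient as the cutoff chosen at `x`.
  refine ⟨fun x => if hx : x ∈ localDomain E F V x₀ then coefficient D (χ ⟨x, hx⟩) x else 0,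
    fun x hx => ?_, fun x hx s => ?_⟩
  · have hU := (isOpen_localDomain E F V x₀).mem_nhds hx
    refine (((contMDiffOn_coefficient D (χ ⟨x, hx⟩)).contMDiffAt hU).congr_of_eventuallyEq
      ?_).contMDiffWithinAt
    filter_upwards [hU, (hχ ⟨x, hx⟩).eventually_nhds] with y hy h1
    rw [dif_pos hy]
    exact coefficient_congr hD hy (hχ ⟨y, hy⟩) h1
  · simp only [dif_pos hx]
    exact fiberCoord_diffOps_apply hD hx (hχ ⟨x, hx⟩) s

end Coefficients

end Manifold

/-! ### Jets, and the isomorphism between sections and operators -/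

section Manifold

variable {E : Type*} [NormedAddCommGroup E] [NormedSpace ℝ E]
  {X : Type*} [TopologicalSpace X] [ChartedSpace E X] [IsManifold 𝓘(ℝ, E) ∞ X]
  {F : Type*} [NormedAddCommGroup F] [NormedSpace ℝ F]
  {V : X → Type*} [TopologicalSpace (Bundle.TotalSpace F V)]
  [∀ x, AddCommGroup (V x)] [∀ x, Module ℝ (V x)] [∀ x, TopologicalSpace (V x)]
  [FiberBundle F V] [VectorBundle ℝ F V] [ContMDiffVectorBundle ∞ F V 𝓘(ℝ, E)]

variable [FiniteDimensional ℝ E] [T2Space X] [FiniteDimensional ℝ F]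

open Filter Topology

theorem contMDiffAt_localDeriv {x₀ x : X} (hx : x ∈ localDomain E F V x₀) (n : ℕ)
    (s : Sections E F V) :
    ContMDiffAt 𝓘(ℝ, E) 𝓘(ℝ, E [×n]→L[ℝ] F) ∞ (fun y => localDeriv x₀ n y s) x :=
  contMDiffAt_comp_chart hx.1
    ((contDiffAt_localRep E F V hx s).iteratedFDeriv_right (by norm_cast))

/-- Multiplication by a function vanishing at `x` raises the vanishing order of a section. -/
theorem localDeriv_smul_eq_zero {x₀ x : X} (hx : x ∈ localDomain E F V x₀) {f : SmoothFun E X}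
    (hf : f x = 0) {s : Sections E F V} {m : ℕ} (hs : ∀ j < m, localDeriv x₀ j x s = 0) :
    ∀ j < m + 1, localDeriv x₀ j x (f • s) = 0 := by
  intro n hn
  rw [← norm_le_zero_iff]
  refine (norm_localDeriv_smul_le E F V hx n f s).trans
    (Finset.sum_eq_zero fun j hj => ?_).le
  -- In Leibniz's sum the term with `f` undifferentiated contains `f x = 0`; every other term leaves
  -- fewer than `m` derivatives on `s`.
  rcases Nat.eq_zero_or_pos j with rfl | hj0
  · rw [norm_iteratedFDeriv_zero, (chartAt E x₀).left_inv hx.1, hf, norm_zero, mul_zero, zero_mul]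
  · rw [hs (n - j) (by have := Finset.mem_range.1 hj; omega), norm_zero, mul_zero]

/-- Each factor vanishing at `x` raises the order of vanishing by one, so `k + 1` factors annihilate
all derivatives of order at most `k`. -/
theorem centeredProd_smul_mem_jetKer {k : ℕ} (x : X) {l : List (SmoothFun E X)}
    (hl : l.length = k + 1) (s : Sections E F V) :
    centeredProd x l • s ∈ jetKer E F V k x := by
  have key : ∀ l : List (SmoothFun E X), ∀ j < l.length,
      localDeriv x j x (centeredProd x l • s) = 0 := by
    intro l
    induction l with
    | nil => intro j hj; simp at hj
    | cons a l ih =>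
      have : centeredProd x (a :: l) =
          (a - algebraMap ℝ (SmoothFun E X) (a x)) * centeredProd x l := rfl
      rw [this, mul_smul]
      exact localDeriv_smul_eq_zero (mem_localDomain_self E F V x) (sub_self (a x)) ih
  exact fun i hi => key l i (by omega)

theorem jet_eq_zero {k : ℕ} {x : X} {s : Sections E F V} :
    jet k x s = 0 ↔ s ∈ jetKer E F V k x :=
  Submodule.Quotient.mk_eq_zero _

theorem jet_congr {k : ℕ} {x : X} {s t : Sections E F V} (h : ∀ᶠ y in 𝓝 x, s y = t y) :
    jet k x s = jet k x t := by
  rw [← sub_eq_zero, ← map_sub, jet_eq_zero]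
  intro i _
  rw [localDeriv_congr (t := 0) (mem_localDomain_self E F V x),
    localDeriv_zero E F V x (mem_localDomain_self E F V x)]
  filter_upwards [h] with y hy
  exact sub_eq_zero.2 hy

variable (E F V) in
/-- The components of the `k`-jet of a section at `x`, in the coordinates at `x`. -/
def jetCoordMap (k : ℕ) (x : X) : Sections E F V →ₗ[ℝ] JetCoord E F k where
  toFun s := fun i => localDeriv x i x s
  map_add' s t := funext fun i => localDeriv_add E F V (mem_localDomain_self E F V x) i s t
  map_smul' c s := funext fun i => localDeriv_const_smul E F V (mem_localDomain_self E F V x) i c s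

theorem ker_jetCoordMap (k : ℕ) (x : X) :
    LinearMap.ker (jetCoordMap E F V k x) = jetKer E F V k x := by
  ext s
  rw [LinearMap.mem_ker]
  constructor
  · intro h i hi
    exact congrFun h ⟨i, by omega⟩
  · intro h
    exact funext fun i => h i (by omega)

/-- Required for `dualTensorHomEquiv`, which identifies elements of `(J^k_x Y)^* ⊗ Y_x` with linear
maps. -/
instance finiteDimensional_jetFibre (k : ℕ) (x : X) : FiniteDimensional ℝ (JetFibre E F V k x) :=
  FiniteDimensional.of_injective
    ((jetKer E F V k x).liftQ (jetCoordMap E F V k x) (ker_jetCoordMap k x).ge)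
    (LinearMap.ker_eq_bot.1 (Submodule.ker_liftQ_eq_bot _ _ _ (ker_jetCoordMap k x).le))

theorem contract_injective {k : ℕ} {x : X} : Function.Injective
    (contract : Module.Dual ℝ (JetFibre E F V k x) ⊗[ℝ] V x → JetFibre E F V k x →ₗ[ℝ] V x) :=
  (dualTensorHomEquiv ℝ (JetFibre E F V k x) (V x)).injective

theorem contract_surjective {k : ℕ} {x : X} : Function.Surjective
    (contract : Module.Dual ℝ (JetFibre E F V k x) ⊗[ℝ] V x → JetFibre E F V k x →ₗ[ℝ] V x) :=
  (dualTensorHomEquiv ℝ (JetFibre E F V k x) (V x)).surjective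

/-- The section `x ↦ A_x(j^k_x s)` for a section `A` of `(J^k Y)^* ⊗ Y`. -/
def jetSection {k : ℕ} (A : jetDualSections E F V k) (s : Sections E F V) : Sections E F V where
  toFun x := contract (A.1 x) (jet k x s)
  contMDiff_toFun x := by
    obtain ⟨a, ha, h⟩ := A.2 x
    have hx := mem_localDomain_self E F V x
    have hU := (isOpen_localDomain E F V x).mem_nhds hx
    rw [Bundle.contMDiffAt_section]
    have h1 : ContMDiffAt 𝓘(ℝ, E) 𝓘(ℝ, JetCoord E F k) ∞
        (fun y => (fun i : Fin (k + 1) => localDeriv x i y s : JetCoord E F k)) x :=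
      contMDiffAt_pi_space.2 fun i => contMDiffAt_localDeriv hx i s
    refine ((ha.contMDiffAt hU).clm_apply h1).congr_of_eventuallyEq ?_
    filter_upwards [hU] with y hy
    exact h y hy s

theorem jetSection_apply {k : ℕ} (A : jetDualSections E F V k) (s : Sections E F V) (x : X) :
    jetSection A s x = contract (A.1 x) (jet k x s) := rfl

theorem jetSection_support {k : ℕ} (A : jetDualSections E F V k) (s : Sections E F V) :
    sectionSupport (jetSection A s) ⊆ sectionSupport s := by
  refine closure_minimal (fun x hx => ?_) isClosed_closure
  by_contra h
  refine hx ?_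
  rw [jetSection_apply, jet_congr (t := 0) (eventually_zero_of_notMem_support h), map_zero,
    map_zero]

/-- The operator `s ↦ (x ↦ A_x(j^k_x s))` on test sections. -/
def jetOperator {k : ℕ} (A : jetDualSections E F V k) :
    testSections E F V →ₗ[ℝ] testSections E F V where
  toFun s := ⟨jetSection A s.1, IsCompact.of_isClosed_subset s.2 isClosed_closure
    (jetSection_support A s.1)⟩
  map_add' s t := Subtype.ext <| ContMDiffSection.ext fun x => by
    change contract (A.1 x) (jet k x (s.1 + t.1)) =
      contract (A.1 x) (jet k x s.1) + contract (A.1 x) (jet k x t.1)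
    rw [map_add, map_add]
  map_smul' c s := Subtype.ext <| ContMDiffSection.ext fun x => by
    change contract (A.1 x) (jet k x (c • s.1)) = c • contract (A.1 x) (jet k x s.1)
    rw [map_smul, map_smul]

theorem jetOperator_apply {k : ℕ} (A : jetDualSections E F V k) (s : testSections E F V) (x : X) :
    (jetOperator A s).1 x = contract (A.1 x) (jet k x s.1) := rfl

/-- At `x` the iterated commutator is, up to sign, `A_x` applied to the jet of a product of `k + 1`
functions vanishing at `x` times `s`, and this jet is zero. -/
theorem jetOperator_mem_diffOps {k : ℕ} (A : jetDualSections E F V k) :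
    jetOperator A ∈ diffOps ℝ (SmoothFun E X) (testSections E F V) (testSections E F V) k := by
  rw [mem_diffOps_iff]
  intro l hl
  refine LinearMap.ext fun s => Subtype.ext <| ContMDiffSection.ext fun x => ?_
  rw [iterDelta_apply_apply, jetOperator_apply]
  have h : jet k x (centeredProd x l • s).1 = 0 :=
    jet_eq_zero.2 (centeredProd_smul_mem_jetKer x hl s.1)
  rw [h, map_zero, smul_zero]
  rfl

variable (E F V) in
/-- The homomorphism of `C^∞(X)`-modules that sends a section of `(J^k Y)^* ⊗ Y` to the associated
differential operator. -/
def jetOperatorHom (k : ℕ) : jetDualSections E F V k →ₗ[SmoothFun E X]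
    diffOps ℝ (SmoothFun E X) (testSections E F V) (testSections E F V) k where
  toFun A := ⟨jetOperator A, jetOperator_mem_diffOps A⟩
  map_add' A B := Subtype.ext <| LinearMap.ext fun s => Subtype.ext <|
    ContMDiffSection.ext fun x => by
      change dualTensorHom ℝ _ _ (A.1 x + B.1 x) _ = _
      rw [map_add]
      rfl
  map_smul' f A := Subtype.ext <| LinearMap.ext fun s => Subtype.ext <|
    ContMDiffSection.ext fun x => by
      change dualTensorHom ℝ _ _ (f x • A.1 x) _ = _
      rw [map_smul]
      rfl

/-- Every jet at `x` is the jet of a compactly supported section, by cutting off a representative;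
hence test sections detect all of `A_x`. -/
theorem jetOperatorHom_injective (k : ℕ) : Function.Injective (jetOperatorHom E F V k) := by
  intro A B h
  refine Subtype.ext (funext fun x => contract_injective (LinearMap.ext fun j => ?_))
  obtain ⟨s, rfl⟩ := Submodule.mkQ_surjective _ j
  obtain ⟨χ, hχ⟩ := exists_cutoff (mem_localDomain_self E F V x)
  have h1 : jet k x s = jet k x (χ.mulTest s).1 := jet_congr (by
    filter_upwards [hχ] with y hy
    rw [χ.mulTest_apply, hy, one_smul])
  change contract (A.1 x) (jet k x s) = contract (B.1 x) (jet k x s)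
  rw [h1, ← jetOperator_apply, ← jetOperator_apply]
  have h2 : jetOperator A = jetOperator B := congrArg Subtype.val h
  rw [h2]

/-- `A_x` applies `D` to a cut-off representative of the jet and evaluates at `x`. This descends to
jets because `D` is given by coefficients acting on derivatives of order at most `k`; the same
coefficients show that `A` is smooth, and locality of `D` removes the cutoffs. -/
theorem jetOperatorHom_surjective (k : ℕ) : Function.Surjective (jetOperatorHom E F V k) := by
  rintro ⟨D, hD⟩
  choose χ hχ using fun x : X => exists_cutoff (mem_localDomain_self E F V x)
  have hloc : ∀ x (s : Sections E F V), ∀ᶠ y in 𝓝 x, ((χ x).mulTest s).1 y = s y := by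
    intro x s
    filter_upwards [hχ x] with y hy
    rw [(χ x).mulTest_apply, hy, one_smul]
  have hker : ∀ x, jetKer E F V k x ≤
      LinearMap.ker (evalAt E F V x ∘ₗ D ∘ₗ (χ x).mulTest) := by
    intro x s hs
    obtain ⟨a, -, ha⟩ := exists_coefficients hD x
    have hx := mem_localDomain_self E F V x
    refine fiberCoord_injective hx ?_
    rw [map_zero]
    refine (ha x hx _).trans ?_
    rw [show (fun i : Fin (k + 1) => localDeriv x i x ((χ x).mulTest s).1) = 0 from ?_, map_zero]
    funext i
    rw [localDeriv_congr hx (hloc x s)]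
    exact hs i (by omega)
  choose A hA using fun x => contract_surjective
    ((jetKer E F V k x).liftQ (evalAt E F V x ∘ₗ D ∘ₗ (χ x).mulTest) (hker x))
  have hAs : ∀ x s, contract (A x) (jet k x s) = (D ((χ x).mulTest s)).1 x := by
    intro x s
    rw [hA]
    rfl
  refine ⟨⟨A, fun x₀ => ?_⟩, Subtype.ext <| LinearMap.ext fun s => Subtype.ext <|
    ContMDiffSection.ext fun x => (hAs x s.1).trans (diffOps_apply_congr hD (hloc x s.1))⟩
  obtain ⟨a, ha, h⟩ := exists_coefficients hD x₀
  refine ⟨a, ha, fun x hx s => ?_⟩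
  rw [hAs, ← fiberCoord_apply hx, h x hx]
  congr 1
  funext i
  exact localDeriv_congr hx (hloc x s) i

variable (E F V) in
/-- The isomorphism of the module of sections of `(J^k Y)^* ⊗ Y` onto the module of differential
operators of order `k` on test sections. -/
def jetOperatorEquiv (k : ℕ) : jetDualSections E F V k ≃ₗ[SmoothFun E X]
    diffOps ℝ (SmoothFun E X) (testSections E F V) (testSections E F V) k :=
  LinearEquiv.ofBijective (jetOperatorHom E F V k)
    ⟨jetOperatorHom_injective k, jetOperatorHom_surjective k⟩

end Manifold

/-! ### Continuity of differential operators on test sections -/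

section Manifold

variable {E : Type*} [NormedAddCommGroup E] [NormedSpace ℝ E]
  {X : Type*} [TopologicalSpace X] [ChartedSpace E X] [IsManifold 𝓘(ℝ, E) ∞ X]
  {F : Type*} [NormedAddCommGroup F] [NormedSpace ℝ F]
  {V : X → Type*} [TopologicalSpace (Bundle.TotalSpace F V)]
  [∀ x, AddCommGroup (V x)] [∀ x, Module ℝ (V x)] [∀ x, TopologicalSpace (V x)]
  [FiberBundle F V] [VectorBundle ℝ F V] [ContMDiffVectorBundle ∞ F V 𝓘(ℝ, E)]

theorem norm_iteratedFDeriv_of_eq_comp {E G H : Type*} [NormedAddCommGroup E] [NormedSpace ℝ E]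
    [NormedAddCommGroup G] [NormedSpace ℝ G] [NormedAddCommGroup H] [NormedSpace ℝ H]
    (e : G ≃ₗᵢ[ℝ] H) {f : E → G} {g : E → H} (h : g = e ∘ f) (m : ℕ) (y : E) :
    ‖iteratedFDeriv ℝ m g y‖ = ‖iteratedFDeriv ℝ m f y‖ := by
  rw [h, LinearIsometryEquiv.norm_iteratedFDeriv_comp_left]

-- Currying multilinear maps is isometric. This turns the Leibniz terms for an operator into
-- ordinary derivatives, as measured by the standard seminorms.
set_option synthInstance.maxHeartbeats 200000 in
theorem norm_iteratedFDeriv_iteratedFDeriv {E F : Type*} [NormedAddCommGroup E] [NormedSpace ℝ E]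
    [NormedAddCommGroup F] [NormedSpace ℝ F] (g : E → F) (y : E) (m j : ℕ) :
    ‖iteratedFDeriv ℝ m (iteratedFDeriv ℝ j g) y‖ = ‖iteratedFDeriv ℝ (m + j) g y‖ := by
  induction j generalizing m with
  | zero =>
    rw [iteratedFDeriv_zero_eq_comp, LinearIsometryEquiv.norm_iteratedFDeriv_comp_left, add_zero]
  | succ j ih =>
    let e : (E →L[ℝ] E [×j]→L[ℝ] F) ≃ₗᵢ[ℝ] E [×(j + 1)]→L[ℝ] F :=
      (continuousMultilinearCurryLeftEquiv ℝ (fun _ : Fin (j + 1) => E) F).symm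
    have h := norm_iteratedFDeriv_of_eq_comp e (f := fderiv ℝ (iteratedFDeriv ℝ j g))
      (g := iteratedFDeriv ℝ (j + 1) g) rfl m y
    rw [h, norm_iteratedFDeriv_fderiv, ih, add_right_comm, add_assoc]

variable [FiniteDimensional ℝ E] [T2Space X] [FiniteDimensional ℝ F]

open Filter Topology

theorem localDeriv_le_smoothSeminorm (i : SeminormIndex E F V) {x : X} (hx : x ∈ i.carrier)
    (s : testSections E F V) : ‖localDeriv i.center i.order x s.1‖ ≤ smoothSeminorm i s :=
  le_ciSup (bddAbove_localDeriv E F V i.order i.isCompact i.subset s.1) ⟨x, hx⟩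

theorem smoothSeminorm_le {i : SeminormIndex E F V} {s : testSections E F V} {C : ℝ} (hC : 0 ≤ C)
    (h : ∀ x ∈ i.carrier, ‖localDeriv i.center i.order x s.1‖ ≤ C) : smoothSeminorm i s ≤ C :=
  Real.iSup_le (fun x => h x x.2) hC

theorem exists_bound_iteratedFDeriv {G : Type*} [NormedAddCommGroup G] [NormedSpace ℝ G]
    (i : SeminormIndex E F V) {f : E → G} (hf : ContDiffOn ℝ ∞ f (localTarget E F V i.center))
    (m : ℕ) : ∃ c : ℝ≥0, ∀ x ∈ i.carrier, ‖iteratedFDeriv ℝ m f (chartAt E i.center x)‖ ≤ c := by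
  have hc : ContinuousOn (fun x => iteratedFDeriv ℝ m f (chartAt E i.center x)) i.carrier := by
    intro x hx
    have h1 := ((hf.contDiffAt ((isOpen_localTarget E F V i.center).mem_nhds
      (mem_localTarget E F V (i.subset hx)))).of_le (m := m)
        (by exact_mod_cast le_top)).continuousAt_iteratedFDeriv le_rfl
    exact (ContinuousAt.comp (f := chartAt E i.center) h1
      ((chartAt E i.center).continuousAt (i.subset hx).1)).continuousWithinAt
  obtain ⟨c, hc⟩ := i.isCompact.exists_bound_of_continuousOn hc
  exact ⟨c.toNNReal, fun x hx => (hc x hx).trans (Real.le_coe_toNNReal c)⟩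

variable {k : ℕ} {D : testSections E F V →ₗ[ℝ] testSections E F V}

/-- Local expressions of the coefficients of a differential operator, in the chart. -/
theorem exists_local_coefficients
    (hD : D ∈ diffOps ℝ (SmoothFun E X) (testSections E F V) (testSections E F V) k) (x₀ : X) :
    ∃ a : (j : Fin (k + 1)) → E → (E [×(j : ℕ)]→L[ℝ] F) →L[ℝ] F,
      (∀ j, ContDiffOn ℝ ∞ (a j) (localTarget E F V x₀)) ∧
      ∀ y ∈ localTarget E F V x₀, ∀ s : testSections E F V,
        localRep x₀ (D s).1 y = ∑ j, a j y (iteratedFDeriv ℝ j (localRep x₀ s.1) y) := by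
  classical
  obtain ⟨a, ha, h⟩ := exists_coefficients hD x₀
  have hmaps : ∀ y ∈ localTarget E F V x₀, (chartAt E x₀).symm y ∈ localDomain E F V x₀ :=
    fun y hy => ⟨(chartAt E x₀).map_target hy.1, hy.2⟩
  refine ⟨fun j y => (a ((chartAt E x₀).symm y)).comp
    (ContinuousLinearMap.single ℝ (fun j : Fin (k + 1) => E [×(j : ℕ)]→L[ℝ] F) j),
    fun j => ?_, fun y hy s => ?_⟩
  · refine ContDiffOn.clm_comp ?_ contDiffOn_const
    rw [← contMDiffOn_iff_contDiffOn]
    have h2 := contMDiffOn_chart_symm (I := 𝓘(ℝ, E)) (n := ∞) (x := x₀)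
    exact ha.comp (h2.mono Set.inter_subset_left) hmaps
  · have h3 := h _ (hmaps y hy) s
    rw [fiberCoord_apply (hmaps y hy)] at h3
    refine h3.trans ?_
    conv_lhs => rw [← LinearMap.sum_single_apply (fun j : Fin (k + 1) => E [×(j : ℕ)]→L[ℝ] F)
      (fun i : Fin (k + 1) => localDeriv x₀ i ((chartAt E x₀).symm y) s.1)]
    rw [map_sum]
    refine Finset.sum_congr rfl fun j _ => ?_
    rw [localDeriv, (chartAt E x₀).right_inv hy.1]
    rfl

/-- Leibniz's rule for `∑ a_j D^j g`: derivatives of the coefficients are bounded on the compact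
carrier, and derivatives of `g` are dominated by seminorms with the same carrier. -/
theorem exists_smoothSeminorm_diffOps_le
    (hD : D ∈ diffOps ℝ (SmoothFun E X) (testSections E F V) (testSections E F V) k)
    (i : SeminormIndex E F V) :
    ∃ (t : Finset (SeminormIndex E F V)) (C : ℝ≥0), ∀ s : testSections E F V,
      smoothSeminorm i (D s) ≤ C * t.sup smoothSeminorm s := by
  classical
  obtain ⟨a, ha, hrep⟩ := exists_local_coefficients hD i.center
  have hU := isOpen_localTarget E F V i.center
  choose c hc using fun (j : Fin (k + 1)) (m : ℕ) => exists_bound_iteratedFDeriv i (ha j) m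
  let idx : ℕ → SeminormIndex E F V := fun m => ⟨i.center, m, i.carrier, i.isCompact, i.subset⟩
  -- The highest derivative of `s` that occurs has order `i.order + k`, included in this range.
  refine ⟨(Finset.range (i.order + k + 1)).image idx, ∑ j : Fin (k + 1),
    ∑ m ∈ Finset.range (i.order + 1), (i.order.choose m : ℝ≥0) * c j m, fun s => ?_⟩
  refine smoothSeminorm_le (mul_nonneg (NNReal.coe_nonneg _) (apply_nonneg _ _)) fun x hx => ?_
  have hm := mem_localTarget E F V (i.subset hx)
  set y := chartAt E i.center x with hy
  set g := localRep i.center s.1 with hgdef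
  have hg : ContDiffOn ℝ ∞ g (localTarget E F V i.center) := contDiffOn_localRep E F V i.center s.1
  have hgj : ∀ j : ℕ, ContDiffOn ℝ ∞ (iteratedFDeriv ℝ j g) (localTarget E F V i.center) :=
    fun j z hz => ((hg.contDiffAt (hU.mem_nhds hz)).iteratedFDeriv_right
      (by norm_cast)).contDiffWithinAt
  have h1 : localDeriv i.center i.order x (D s).1 =
      ∑ j : Fin (k + 1), iteratedFDerivWithin ℝ i.order
        (fun z => a j z (iteratedFDeriv ℝ j g z)) (localTarget E F V i.center) y := by
    rw [localDeriv, ← iteratedFDerivWithin_of_isOpen _ hU hm,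
      iteratedFDerivWithin_congr (fun z hz => hrep z hz s) hm]
    refine iteratedFDerivWithin_fun_sum_apply hU.uniqueDiffOn hm fun j _ => ?_
    exact (((ha j).clm_apply (hgj j)).contDiffWithinAt hm).of_le (by exact_mod_cast le_top)
  rw [h1]
  refine (norm_sum_le _ _).trans ?_
  push_cast
  rw [Finset.sum_mul]
  refine Finset.sum_le_sum fun j _ => ?_
  refine (norm_iteratedFDerivWithin_clm_apply (ha j) (hgj j) hU.uniqueDiffOn hm
    (n := i.order) (by exact_mod_cast le_top)).trans ?_
  rw [Finset.sum_mul]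
  refine Finset.sum_le_sum fun m hmr => ?_
  rw [iteratedFDerivWithin_of_isOpen _ hU hm, iteratedFDerivWithin_of_isOpen _ hU hm,
    norm_iteratedFDeriv_iteratedFDeriv]
  have h2 : ‖iteratedFDeriv ℝ (i.order - m + j) g y‖ ≤
      ((Finset.range (i.order + k + 1)).image idx).sup smoothSeminorm s := by
    refine (localDeriv_le_smoothSeminorm (idx (i.order - m + j)) hx s).trans ?_
    exact Seminorm.le_finset_sup_apply (Finset.mem_image_of_mem idx
      (Finset.mem_range.2 (by omega)))
  have h3 := hc j m x hx
  gcongr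

/-- Since supports are not enlarged, `D` preserves each `𝒟_K(Y)`, where `p` is bounded by finitely
many standard seminorms; these are estimated one at a time. -/
theorem isLFSeminorm_comp_diffOps
    (hD : D ∈ diffOps ℝ (SmoothFun E X) (testSections E F V) (testSections E F V) k)
    {p : Seminorm ℝ (testSections E F V)} (hp : IsLFSeminorm p) : IsLFSeminorm (p.comp D) := by
  classical
  intro K hK
  obtain ⟨t, C, h⟩ := hp K hK
  choose u B hu using exists_smoothSeminorm_diffOps_le hD
  refine ⟨t.biUnion u, C * ∑ i ∈ t, B i, fun s hs => ?_⟩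
  have hDs : sectionSupport (D s).1 ⊆ K := by
    refine Set.Subset.trans (closure_minimal (fun x hx => ?_) isClosed_closure) hs
    by_contra h0
    exact hx (diffOps_apply_eq_zero hD (eventually_zero_of_notMem_support h0))
  refine (h (D s) hDs).trans ?_
  rw [NNReal.coe_mul, mul_assoc]
  refine mul_le_mul_of_nonneg_left ?_ C.coe_nonneg
  refine Seminorm.finset_sup_apply_le (mul_nonneg (NNReal.coe_nonneg _) (apply_nonneg _ _)) ?_
  intro i hi
  refine (hu i s).trans (mul_le_mul ?_ ?_ (apply_nonneg _ _) (NNReal.coe_nonneg _))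
  · exact_mod_cast Finset.single_le_sum (f := B) (fun _ _ => zero_le) hi
  · exact Seminorm.le_def.1 (Finset.sup_mono (Finset.subset_biUnion_of_mem u hi)) s

/-- Differential operators on test sections are continuous. -/
theorem continuous_of_mem_diffOps
    (hD : D ∈ diffOps ℝ (SmoothFun E X) (testSections E F V) (testSections E F V) k) :
    Continuous D :=
  (test_withSeminorms E F V).continuous_of_continuous_comp _ fun p =>
    (test_withSeminorms E F V).continuous_seminorm ⟨_, isLFSeminorm_comp_diffOps hD p.2⟩

end Manifold

/-! ### Pointwise limits of smooth functions with locally bounded derivatives -/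

section LimitOfSmooth

open Filter Topology Metric

variable {ι : Type*} {l : Filter ι} [NeBot l]
  {E : Type*} [NormedAddCommGroup E] [NormedSpace ℝ E]
  {G : Type*} [NormedAddCommGroup G] [NormedSpace ℝ G]

/-- The mean value inequality on the ball of radius `‖z - y‖`, where the derivative differs from its
value at `y` by at most `M * ‖z - y‖`. -/
theorem norm_sub_sub_fderiv_le {f : E → G} {y : E} {r M : ℝ}
    (hf : ∀ x ∈ closedBall y r, DifferentiableAt ℝ f x)
    (hM : ∀ x ∈ closedBall y r, ‖fderiv ℝ f x - fderiv ℝ f y‖ ≤ M * ‖x - y‖) (hM0 : 0 ≤ M)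
    {z : E} (hz : z ∈ closedBall y r) :
    ‖f z - f y - fderiv ℝ f y (z - y)‖ ≤ M * ‖z - y‖ * ‖z - y‖ := by
  have hsub : closedBall y ‖z - y‖ ⊆ closedBall y r :=
    closedBall_subset_closedBall (by rwa [mem_closedBall, dist_eq_norm] at hz)
  refine (convex_closedBall y ‖z - y‖).norm_image_sub_le_of_norm_fderiv_le'
    (fun x hx => hf x (hsub hx)) (fun x hx => (hM x (hsub hx)).trans ?_)
    (mem_closedBall_self (norm_nonneg _)) (by rw [mem_closedBall, dist_eq_norm])
  rw [mem_closedBall, dist_eq_norm] at hx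
  gcongr

/-- A pointwise limit of functions with uniformly bounded second order Taylor remainders and with
converging derivatives is differentiable. -/
theorem hasFDerivAt_of_tendsto {f : ι → E → G} {u : E → G} {u' : E →L[ℝ] G} {y : E} {r M : ℝ}
    (hr : 0 < r)
    (hM : ∀ᶠ s in l, ∀ z ∈ closedBall y r,
      ‖f s z - f s y - fderiv ℝ (f s) y (z - y)‖ ≤ M * ‖z - y‖ * ‖z - y‖)
    (hu : ∀ z ∈ closedBall y r, Tendsto (fun s => f s z) l (𝓝 (u z)))
    (hu' : ∀ v, Tendsto (fun s => fderiv ℝ (f s) y v) l (𝓝 (u' v))) :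
    HasFDerivAt u u' y := by
  -- The quadratic remainder bound has a constant independent of the index, so it survives the
  -- pointwise limit.
  have key : ∀ z ∈ closedBall y r, ‖u z - u y - u' (z - y)‖ ≤ M * ‖z - y‖ * ‖z - y‖ := by
    intro z hz
    refine le_of_tendsto (((hu z hz).sub (hu y (mem_closedBall_self hr.le))).sub
      (hu' (z - y))).norm ?_
    filter_upwards [hM] with s hs using hs z hz
  refine HasFDerivAt.of_isLittleO (Asymptotics.isLittleO_iff.2 fun c hc => ?_)
  have h1 : Tendsto (fun z => M * ‖z - y‖) (𝓝 y) (𝓝 0) := by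
    have : Continuous fun z => M * ‖z - y‖ := by fun_prop
    simpa using this.tendsto y
  filter_upwards [closedBall_mem_nhds y hr, h1.eventually (ge_mem_nhds hc)] with z hz hzc
  exact (key z hz).trans (by gcongr)

variable {F : Type*} [NormedAddCommGroup F] [NormedSpace ℝ F]

theorem norm_iteratedFDeriv_sub_le {f : E → F} {U : Set E} (hU : IsOpen U)
    (hf : ContDiffOn ℝ ∞ f U) {y : E} {r : ℝ} (hrU : closedBall y r ⊆ U) {n : ℕ} {M : ℝ}
    (hM : ∀ z ∈ closedBall y r, ‖iteratedFDeriv ℝ (n + 1) f z‖ ≤ M) {z w : E}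
    (hz : z ∈ closedBall y r) (hw : w ∈ closedBall y r) :
    ‖iteratedFDeriv ℝ n f z - iteratedFDeriv ℝ n f w‖ ≤ M * ‖z - w‖ := by
  refine (convex_closedBall y r).norm_image_sub_le_of_norm_fderiv_le (𝕜 := ℝ)
    (fun x hx => ?_) (fun x hx => ?_) hw hz
  · exact (hf.contDiffAt (hU.mem_nhds (hrU hx))).differentiableAt_iteratedFDeriv
      (by exact_mod_cast ENat.natCast_lt_top n)
  · rw [norm_fderiv_iteratedFDeriv]
    exact hM x hx

/-- A family of functions on `U` all of whose derivatives are locally bounded, uniformly along the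
filter, and converge pointwise along the filter. -/
structure TendstoSmoothly (l : Filter ι) (U : Set E) (f : ι → E → F)
    (u : (n : ℕ) → E → E [×n]→L[ℝ] F) : Prop where
  contDiffOn : ∀ᶠ s in l, ContDiffOn ℝ ∞ (f s) U
  bounded : ∀ y ∈ U, ∃ r > 0, closedBall y r ⊆ U ∧
    ∀ n : ℕ, ∃ M : ℝ, ∀ᶠ s in l, ∀ z ∈ closedBall y r, ‖iteratedFDeriv ℝ n (f s) z‖ ≤ M
  tendsto : ∀ n, ∀ y ∈ U, Tendsto (fun s => iteratedFDeriv ℝ n (f s) y) l (𝓝 (u n y))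

variable {U : Set E} {f : ι → E → F} {u : (n : ℕ) → E → E [×n]→L[ℝ] F}

theorem norm_map_sub_map_of_isometry {G H : Type*} [NormedAddCommGroup G] [NormedSpace ℝ G]
    [NormedAddCommGroup H] [NormedSpace ℝ H] (e : G ≃ₗᵢ[ℝ] H) {a b : G} {c d : H}
    (hc : c = e a) (hd : d = e b) : ‖c - d‖ = ‖a - b‖ := by
  rw [hc, hd, ← map_sub, LinearIsometryEquiv.norm_map]

theorem tendsto_isometry_apply {G H : Type*} [NormedAddCommGroup G] [NormedSpace ℝ G]
    [NormedAddCommGroup H] [NormedSpace ℝ H] (e : G ≃ₗᵢ[ℝ] (E →L[ℝ] H)) {T : ι → G} {T₀ : G}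
    (hT : Tendsto T l (𝓝 T₀)) (v : E) : Tendsto (fun s => e (T s) v) l (𝓝 (e T₀ v)) :=
  (((ContinuousLinearMap.apply ℝ H v).continuous.comp e.continuous).tendsto T₀).comp hT

set_option synthInstance.maxHeartbeats 200000 in
theorem norm_fderiv_iteratedFDeriv_sub {E F : Type*} [NormedAddCommGroup E] [NormedSpace ℝ E]
    [NormedAddCommGroup F] [NormedSpace ℝ F] (f : E → F) (n : ℕ) (x y : E) :
    ‖fderiv ℝ (iteratedFDeriv ℝ n f) x - fderiv ℝ (iteratedFDeriv ℝ n f) y‖ =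
      ‖iteratedFDeriv ℝ (n + 1) f x - iteratedFDeriv ℝ (n + 1) f y‖ := by
  let e : (E [×(n + 1)]→L[ℝ] F) ≃ₗᵢ[ℝ] (E →L[ℝ] E [×n]→L[ℝ] F) :=
    continuousMultilinearCurryLeftEquiv ℝ (fun _ : Fin (n + 1) => E) F
  exact norm_map_sub_map_of_isometry (H := E →L[ℝ] E [×n]→L[ℝ] F) e (a := iteratedFDeriv ℝ (n + 1) f x)
    (b := iteratedFDeriv ℝ (n + 1) f y) rfl rfl

-- The bound on derivatives of order `n + 2` makes those of order `n + 1` uniformly Lipschitz, hence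
-- the first-order remainders of the `n`-th derivatives uniformly quadratic. Pointwise convergence
-- then suffices to differentiate the limit.
set_option synthInstance.maxHeartbeats 200000 in
theorem TendstoSmoothly.hasFDerivAt (h : TendstoSmoothly l U f u) (hU : IsOpen U) (n : ℕ) {y : E}
    (hy : y ∈ U) : HasFDerivAt (u n) (u (n + 1) y).curryLeft y := by
  obtain ⟨r, hr, hrU, hb⟩ := h.bounded y hy
  obtain ⟨M, hM⟩ := hb (n + 2)
  refine hasFDerivAt_of_tendsto (M := M) (f := fun s => iteratedFDeriv ℝ n (f s)) (l := l) hr ?_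
    (fun z hz => h.tendsto n z (hrU hz)) (fun v => ?_)
  · filter_upwards [h.contDiffOn, hM] with s hs hMs z hz
    refine norm_sub_sub_fderiv_le (fun x hx => ?_) (fun x hx => ?_) ?_ hz
    · exact (hs.contDiffAt (hU.mem_nhds (hrU hx))).differentiableAt_iteratedFDeriv
        (by exact_mod_cast ENat.natCast_lt_top n)
    · rw [norm_fderiv_iteratedFDeriv_sub]
      exact norm_iteratedFDeriv_sub_le hU hs hrU hMs hx (mem_closedBall_self hr.le)
    · exact (norm_nonneg _).trans (hMs y (mem_closedBall_self hr.le))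
  · exact tendsto_isometry_apply
      (continuousMultilinearCurryLeftEquiv ℝ (fun _ : Fin (n + 1) => E) F)
      (h.tendsto (n + 1) y hy) v

theorem TendstoSmoothly.hasFTaylorSeriesUpToOn (h : TendstoSmoothly l U f u) (hU : IsOpen U) :
    HasFTaylorSeriesUpToOn ∞ (fun y => (u 0 y).curry0) (fun y n => u n y) U where
  zero_eq _ _ := rfl
  fderivWithin n _ _ hy := (h.hasFDerivAt hU n hy).hasFDerivWithinAt
  cont n _ _ hy := (h.hasFDerivAt hU n hy).continuousAt.continuousWithinAt

theorem TendstoSmoothly.contDiffOn_limit (h : TendstoSmoothly l U f u) (hU : IsOpen U) :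
    ContDiffOn ℝ ∞ (fun y => (u 0 y).curry0) U :=
  (h.hasFTaylorSeriesUpToOn hU).contDiffOn

theorem TendstoSmoothly.iteratedFDeriv_limit (h : TendstoSmoothly l U f u) (hU : IsOpen U) (n : ℕ)
    {y : E} (hy : y ∈ U) : iteratedFDeriv ℝ n (fun y => (u 0 y).curry0) y = u n y := by
  rw [← iteratedFDerivWithin_of_isOpen _ hU hy]
  exact ((h.hasFTaylorSeriesUpToOn hU).eq_iteratedFDerivWithin_of_uniqueDiffOn
    (by exact_mod_cast le_top) hU.uniqueDiffOn hy).symm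

/-- The convergence of the derivatives is locally uniform. -/
theorem TendstoSmoothly.eventually_norm_sub_le (h : TendstoSmoothly l U f u) (hU : IsOpen U) (n : ℕ)
    {y : E} (hy : y ∈ U) {ε : ℝ} (hε : 0 < ε) :
    ∃ W ∈ 𝓝 y, ∀ᶠ s in l, ∀ z ∈ W, ‖iteratedFDeriv ℝ n (f s) z - u n z‖ ≤ ε := by
  obtain ⟨r, hr, hrU, hb⟩ := h.bounded y hy
  obtain ⟨M, hM⟩ := hb (n + 1)
  have hy' := mem_closedBall_self (x := y) hr.le
  have hlip : ∀ᶠ s in l, ∀ z ∈ closedBall y r,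
      ‖iteratedFDeriv ℝ n (f s) z - iteratedFDeriv ℝ n (f s) y‖ ≤ M * ‖z - y‖ := by
    filter_upwards [h.contDiffOn, hM] with s hs hMs z hz
    exact norm_iteratedFDeriv_sub_le hU hs hrU hMs hz hy'
  have hlim : ∀ z ∈ closedBall y r, ‖u n z - u n y‖ ≤ M * ‖z - y‖ := by
    intro z hz
    refine le_of_tendsto ((h.tendsto n z (hrU hz)).sub (h.tendsto n y hy)).norm ?_
    filter_upwards [hlip] with s hs using hs z hz
  have h1 : Tendsto (fun z => M * ‖z - y‖) (𝓝 y) (𝓝 0) := by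
    have : Continuous fun z => M * ‖z - y‖ := by fun_prop
    simpa using this.tendsto y
  -- One third each for the variation of the approximants near `y`, the convergence at `y`, and the
  -- variation of the limit.
  have hε3 : 0 < ε / 3 := by positivity
  refine ⟨closedBall y r ∩ {z | M * ‖z - y‖ ≤ ε / 3},
    inter_mem (closedBall_mem_nhds y hr) (h1.eventually (ge_mem_nhds hε3)), ?_⟩
  have h2 := (tendsto_iff_norm_sub_tendsto_zero.1 (h.tendsto n y hy)).eventually (ge_mem_nhds hε3)
  filter_upwards [hlip, h2] with s hs hs2 z hz
  have e : iteratedFDeriv ℝ n (f s) z - u n z =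
      (iteratedFDeriv ℝ n (f s) z - iteratedFDeriv ℝ n (f s) y) +
        (iteratedFDeriv ℝ n (f s) y - u n y) - (u n z - u n y) := by abel
  have h3 := (hs z hz.1).trans hz.2
  have h4 := (hlim z hz.1).trans hz.2
  rw [e]
  refine (norm_sub_le _ _).trans ?_
  have h5 := norm_add_le (iteratedFDeriv ℝ n (f s) z - iteratedFDeriv ℝ n (f s) y)
    (iteratedFDeriv ℝ n (f s) y - u n y)
  linarith

end LimitOfSmooth

/-! ### Compactness of sets of test sections with bounded derivatives -/

section Manifold

variable {E : Type*} [NormedAddCommGroup E] [NormedSpace ℝ E]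
  {X : Type*} [TopologicalSpace X] [ChartedSpace E X] [IsManifold 𝓘(ℝ, E) ∞ X]
  {F : Type*} [NormedAddCommGroup F] [NormedSpace ℝ F]
  {V : X → Type*} [TopologicalSpace (Bundle.TotalSpace F V)]
  [∀ x, AddCommGroup (V x)] [∀ x, Module ℝ (V x)] [∀ x, TopologicalSpace (V x)]
  [FiberBundle F V] [VectorBundle ℝ F V] [ContMDiffVectorBundle ∞ F V 𝓘(ℝ, E)]

variable [FiniteDimensional ℝ E] [T2Space X] [FiniteDimensional ℝ F]

open Filter Topology Metric

/-- The set of test sections supported in `K` with prescribed bounds of all standard seminorms. -/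
def boundedTests (K : Set X) (M : SeminormIndex E F V → ℝ) : Set (testSections E F V) :=
  {s | sectionSupport s.1 ⊆ K ∧ ∀ i, smoothSeminorm i s ≤ M i}

/-- The index of the seminorm that belongs to a closed ball in the chart at `x₀`. -/
def ballIndex (x₀ : X) (n : ℕ) {y : E} {r : ℝ} (h : closedBall y r ⊆ localTarget E F V x₀) :
    SeminormIndex E F V where
  center := x₀
  order := n
  carrier := (chartAt E x₀).symm '' closedBall y r
  isCompact := by
    have := FiniteDimensional.proper_real E
    exact (isCompact_closedBall y r).image_of_continuousOn
      ((chartAt E x₀).continuousOn_symm.mono fun z hz => (h hz).1)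
  subset := by
    rintro _ ⟨z, hz, rfl⟩
    exact ⟨(chartAt E x₀).map_target (h hz).1, (h hz).2⟩

theorem norm_iteratedFDeriv_le_ballIndex (x₀ : X) (n : ℕ) {y : E} {r : ℝ}
    (h : closedBall y r ⊆ localTarget E F V x₀) (s : testSections E F V) {z : E}
    (hz : z ∈ closedBall y r) :
    ‖iteratedFDeriv ℝ n (localRep x₀ s.1) z‖ ≤ smoothSeminorm (ballIndex x₀ n h) s := by
  have := localDeriv_le_smoothSeminorm (ballIndex x₀ n h) ⟨z, hz, rfl⟩ s
  rwa [localDeriv, show chartAt E (ballIndex x₀ n h).center ((chartAt E x₀).symm z) = z from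
    (chartAt E x₀).right_inv (h hz).1] at this

variable {K : Set X} {M : SeminormIndex E F V → ℝ} {U : Ultrafilter (testSections E F V)}

/-- Along the ultrafilter each derivative at each point stays in a closed ball of a
finite-dimensional space, hence converges; no subsequences or diagonal argument are needed. -/
theorem exists_tendstoSmoothly (hU : boundedTests K M ∈ U) (x₀ : X) :
    ∃ u : (n : ℕ) → E → E [×n]→L[ℝ] F,
      TendstoSmoothly (U : Filter (testSections E F V)) (localTarget E F V x₀)
        (fun s => localRep x₀ s.1) u := by
  have hex : ∀ (n : ℕ) (y : E), ∃ L : E [×n]→L[ℝ] F, y ∈ localTarget E F V x₀ →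
      Tendsto (fun s : testSections E F V => iteratedFDeriv ℝ n (localRep x₀ s.1) y) U (𝓝 L) := by
    intro n y
    by_cases hy : y ∈ localTarget E F V x₀
    · have h0 : closedBall y 0 ⊆ localTarget E F V x₀ := by
        rw [closedBall_zero]
        exact Set.singleton_subset_iff.2 hy
      have := FiniteDimensional.proper_real (E [×n]→L[ℝ] F)
      have hmem : ∀ᶠ T in (U.map fun s : testSections E F V =>
          iteratedFDeriv ℝ n (localRep x₀ s.1) y : Filter (E [×n]→L[ℝ] F)),
          T ∈ closedBall 0 (M (ballIndex x₀ n h0)) := by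
        refine eventually_map.2 (mem_of_superset hU fun s hs => ?_)
        rw [Set.mem_ofPred_eq, mem_closedBall_zero_iff]
        exact (norm_iteratedFDeriv_le_ballIndex x₀ n h0 s (mem_closedBall_self le_rfl)).trans
          (hs.2 _)
      obtain ⟨L, -, hL⟩ := (isCompact_closedBall _ _).ultrafilter_le_nhds' _ hmem
      exact ⟨L, fun _ => hL⟩
    · exact ⟨0, fun h => absurd h hy⟩
  choose u hu using hex
  refine ⟨u, Eventually.of_forall fun s => contDiffOn_localRep E F V x₀ s.1, fun y hy => ?_, hu⟩
  obtain ⟨r, hr, hrU⟩ :=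
    nhds_basis_closedBall.mem_iff.1 ((isOpen_localTarget E F V x₀).mem_nhds hy)
  refine ⟨r, hr, hrU, fun n => ⟨M (ballIndex x₀ n hrU), ?_⟩⟩
  filter_upwards [hU] with s hs z hz
  exact (norm_iteratedFDeriv_le_ballIndex x₀ n hrU s hz).trans (hs.2 _)

/-- Ultrafilters on a bounded set of test sections with fixed support have limits. -/
theorem exists_limit_section (hK : IsCompact K) (hU : boundedTests K M ∈ U) :
    ∃ s₀ ∈ boundedTests K M, ∀ i, ∀ ε > 0, ∀ᶠ s in U, smoothSeminorm i (s - s₀) ≤ ε := by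
  choose u hu using fun x₀ : X => exists_tendstoSmoothly hU x₀
  let σ : (x : X) → V x := fun x =>
    (trivializationAt F V x).symmₗ ℝ x (u x 0 (chartAt E x x)).curry0
  have hval : ∀ {x₀ x : X}, x ∈ localDomain E F V x₀ → Tendsto
      (fun s : testSections E F V => fiberCoord F V x₀ x (s.1 x)) U
        (𝓝 (u x₀ 0 (chartAt E x₀ x)).curry0) := by
    intro x₀ x hx
    have h1 := (hu x₀).tendsto 0 _ (mem_localTarget E F V hx)
    have h2 := ((continuousMultilinearCurryFin0 ℝ E F).continuous.tendsto _).comp h1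
    refine h2.congr fun s => ?_
    rw [← localRep_chartAt hx]
    rfl
  -- The limit at `x` was taken in the trivialization at `x`. The change of trivialization is linear
  -- on a finite-dimensional space, hence continuous, so by uniqueness of limits every other
  -- trivialization gives the same vector.
  have hσ : ∀ {x₀ x : X}, x ∈ localDomain E F V x₀ →
      fiberCoord F V x₀ x (σ x) = (u x₀ 0 (chartAt E x₀ x)).curry0 := by
    intro x₀ x hx
    have hxx := mem_localDomain_self E F V x
    let T : F →ₗ[ℝ] F := fiberCoord F V x₀ x ∘ₗ (trivializationAt F V x).symmₗ ℝ x
    have hT : Continuous T := T.continuous_of_finiteDimensional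
    have h1 := (hT.tendsto _).comp (hval hxx)
    refine tendsto_nhds_unique (h1.congr fun s => ?_) (hval hx)
    change fiberCoord F V x₀ x ((trivializationAt F V x).symmₗ ℝ x (fiberCoord F V x x (s.1 x))) = _
    rw [fiberCoord, fiberCoord, (trivializationAt F V x).symmₗ_linearMapAt hxx.2]
  have hsmooth : ContMDiff 𝓘(ℝ, E) (𝓘(ℝ, E).prod 𝓘(ℝ, F)) ∞
      (fun x => Bundle.TotalSpace.mk' F x (σ x)) := by
    intro x
    have hx := mem_localDomain_self E F V x
    rw [Bundle.contMDiffAt_section]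
    refine (contMDiffAt_comp_chart hx.1 (((hu x).contDiffOn_limit
      (isOpen_localTarget E F V x)).contDiffAt ((isOpen_localTarget E F V x).mem_nhds
        (mem_localTarget E F V hx)))).congr_of_eventuallyEq ?_
    filter_upwards [(isOpen_localDomain E F V x).mem_nhds hx] with y hy
    rw [← fiberCoord_apply hy, hσ hy]
  let S : Sections E F V := ⟨σ, hsmooth⟩
  have hSK : sectionSupport S ⊆ K := by
    refine closure_minimal (fun x hx => ?_) hK.isClosed
    by_contra hxK
    refine hx ?_
    have hxx := mem_localDomain_self E F V x
    refine fiberCoord_injective hxx ?_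
    rw [map_zero]
    refine (hσ hxx).trans (tendsto_nhds_unique (hval hxx) (tendsto_const_nhds.congr' ?_))
    filter_upwards [hU] with s hs
    have h0 : s.1 x = 0 := by
      by_contra h
      exact hxK (hs.1 (subset_closure h))
    rw [h0, map_zero]
  let s₀ : testSections E F V := ⟨S, hK.of_isClosed_subset isClosed_closure hSK⟩
  have hderiv : ∀ {x₀ x : X}, x ∈ localDomain E F V x₀ → ∀ n : ℕ,
      localDeriv x₀ n x S = u x₀ n (chartAt E x₀ x) := by
    intro x₀ x hx n
    have hm := mem_localTarget E F V hx
    have hO := isOpen_localTarget E F V x₀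
    rw [← (hu x₀).iteratedFDeriv_limit hO n hm, localDeriv]
    refine (Filter.EventuallyEq.iteratedFDeriv ℝ ?_ n).eq_of_nhds
    filter_upwards [hO.mem_nhds hm] with y hy
    have hy' : (chartAt E x₀).symm y ∈ localDomain E F V x₀ :=
      ⟨(chartAt E x₀).map_target hy.1, hy.2⟩
    have h1 := hσ hy'
    rw [(chartAt E x₀).right_inv hy.1, fiberCoord_apply hy'] at h1
    exact h1
  have hlim : ∀ i : SeminormIndex E F V, ∀ x ∈ i.carrier, Tendsto
      (fun s : testSections E F V => localDeriv i.center i.order x s.1) U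
        (𝓝 (localDeriv i.center i.order x s₀.1)) := by
    intro i x hx
    rw [hderiv (i.subset hx)]
    exact (hu i.center).tendsto _ _ (mem_localTarget E F V (i.subset hx))
  refine ⟨s₀, ⟨hSK, fun i => ?_⟩, fun i ε hε => ?_⟩
  · obtain ⟨s, hs⟩ := U.nonempty_of_mem hU
    refine smoothSeminorm_le ((apply_nonneg _ _).trans (hs.2 i)) fun x hx => ?_
    refine le_of_tendsto (hlim i x hx).norm ?_
    filter_upwards [hU] with s hs
    exact (localDeriv_le_smoothSeminorm i hx s).trans (hs.2 i)
  · have hunif : ∀ᶠ s in (U : Filter (testSections E F V)), ∀ x ∈ i.carrier,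
        ‖localDeriv i.center i.order x s.1 - localDeriv i.center i.order x S‖ ≤ ε := by
      -- Locally uniform convergence becomes uniform on the compact carrier. Domain membership is
      -- part of the predicate, since the neighbourhoods in the induction may leave the carrier.
      refine i.isCompact.induction_on (p := fun L => ∀ᶠ s in (U : Filter (testSections E F V)),
        ∀ x ∈ L, x ∈ localDomain E F V i.center →
          ‖localDeriv i.center i.order x s.1 - localDeriv i.center i.order x S‖ ≤ ε)
        ?_ ?_ ?_ ?_ |>.mono fun s hs x hx => hs x hx (i.subset hx)
      · exact Eventually.of_forall fun s x hx => absurd hx (Set.notMem_empty x)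
      · intro L L' hLL' h
        exact h.mono fun s hs x hx => hs x (hLL' hx)
      · intro L L' h h'
        filter_upwards [h, h'] with s hs hs' x hx
        exact hx.elim (hs x) (hs' x)
      · intro x hx
        have hxd := i.subset hx
        obtain ⟨W, hW, hWs⟩ := (hu i.center).eventually_norm_sub_le
          (isOpen_localTarget E F V i.center) i.order (mem_localTarget E F V hxd) hε
        refine ⟨chartAt E i.center ⁻¹' W, mem_nhdsWithin_of_mem_nhds
          (((chartAt E i.center).continuousAt hxd.1) hW), ?_⟩
        filter_upwards [hWs] with s hs z hz hzd
        rw [hderiv hzd]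
        exact hs _ hz
    filter_upwards [hunif] with s hs
    refine smoothSeminorm_le hε.le fun x hx => ?_
    have h1 := localDeriv_add E F V (i.subset hx) i.order (s - s₀).1 s₀.1
    rw [show (s - s₀).1 + s₀.1 = s.1 from sub_add_cancel s.1 s₀.1] at h1
    rw [← sub_eq_iff_eq_add] at h1
    rw [← h1]
    exact hs x hx

/-- Ultrafilter limits exist in all standard seminorms. Differences from the limit are supported in
`K`, where finitely many such seminorms control any LF-seminorm, so the convergence holds in the
LF-topology. -/
theorem isCompact_boundedTests (hK : IsCompact K) : IsCompact (boundedTests K M) := by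
  rw [isCompact_iff_ultrafilter_le_nhds']
  intro U hU
  obtain ⟨s₀, hs₀, hlim⟩ := exists_limit_section hK hU
  refine ⟨s₀, hs₀, ?_⟩
  have : Tendsto id (U : Filter (testSections E F V)) (𝓝 s₀) := by
    rw [(test_withSeminorms E F V).tendsto_nhds]
    rintro ⟨p, hp⟩ ε hε
    obtain ⟨t, C, hC⟩ := hp K hK
    -- `C + 1` avoids division by zero and makes the final inequality strict.
    have hε' : 0 < ε / (C + 1) := by positivity
    filter_upwards [hU, t.eventually_all.2 fun i _ => hlim i _ hε'] with s hs hst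
    have hsupp : sectionSupport (s - s₀).1 ⊆ K := by
      refine closure_minimal (fun x hx => ?_) hK.isClosed
      by_contra hxK
      have h1 : s.1 x = 0 := by
        by_contra h
        exact hxK (hs.1 (subset_closure h))
      have h2 : s₀.1 x = 0 := by
        by_contra h
        exact hxK (hs₀.1 (subset_closure h))
      refine hx ?_
      change s.1 x - s₀.1 x = 0
      rw [h1, h2, sub_zero]
    refine (hC _ hsupp).trans_lt ?_
    have h3 : t.sup smoothSeminorm (s - s₀) ≤ ε / (C + 1) :=
      Seminorm.finset_sup_apply_le hε'.le hst
    have h4 : (0 : ℝ) ≤ C := C.coe_nonneg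
    calc (C : ℝ) * t.sup smoothSeminorm (s - s₀) ≤ C * (ε / (C + 1)) := by gcongr
      _ < ε := by
        rw [mul_div_assoc', div_lt_iff₀ (by positivity)]
        nlinarith
  exact this

end Manifold

/-! ### Bounded sets and semireflexivity -/

section Manifold

variable {E : Type*} [NormedAddCommGroup E] [NormedSpace ℝ E]
  {X : Type*} [TopologicalSpace X] [ChartedSpace E X] [IsManifold 𝓘(ℝ, E) ∞ X]
  {F : Type*} [NormedAddCommGroup F] [NormedSpace ℝ F]
  {V : X → Type*} [TopologicalSpace (Bundle.TotalSpace F V)]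
  [∀ x, AddCommGroup (V x)] [∀ x, Module ℝ (V x)] [∀ x, TopologicalSpace (V x)]
  [FiberBundle F V] [VectorBundle ℝ F V] [ContMDiffVectorBundle ∞ F V 𝓘(ℝ, E)]

variable [FiniteDimensional ℝ E] [T2Space X] [FiniteDimensional ℝ F]

open Filter Topology Metric

theorem isLFSeminorm_smoothSeminorm (i : SeminormIndex E F V) :
    IsLFSeminorm (smoothSeminorm i) := fun _ _ => ⟨{i}, 1, fun s _ => by simp⟩

variable (E F V) in
/-- The index of the seminorm that is the norm of the value at a point. -/
def pointIndex (x : X) : SeminormIndex E F V where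
  center := x
  order := 0
  carrier := {x}
  isCompact := isCompact_singleton
  subset := Set.singleton_subset_iff.2 (mem_localDomain_self E F V x)

theorem smoothSeminorm_pointIndex_eq_zero {x : X} {s : testSections E F V} :
    smoothSeminorm (pointIndex E F V x) s = 0 ↔ s.1 x = 0 := by
  have hx := mem_localDomain_self E F V x
  have h0 : ‖localDeriv x 0 x s.1‖ = ‖fiberCoord F V x x (s.1 x)‖ := by
    rw [localDeriv, norm_iteratedFDeriv_zero, localRep_chartAt hx]
  constructor
  · intro h
    have h1 := localDeriv_le_smoothSeminorm (pointIndex E F V x) (Set.mem_singleton x) s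
    rw [h] at h1
    have h2 : ‖fiberCoord F V x x (s.1 x)‖ ≤ 0 := h0 ▸ h1
    refine fiberCoord_injective hx ?_
    rw [map_zero]
    exact norm_le_zero_iff.1 h2
  · intro h
    refine le_antisymm (smoothSeminorm_le le_rfl ?_) (apply_nonneg _ _)
    rintro y rfl
    refine h0.le.trans ?_
    rw [h, map_zero, norm_zero]

/-- Point values already separate test sections. With local convexity this provides the separating
dual used in `test_ext_of_distributions`. -/
instance testT1Space : T1Space (testSections E F V) := by
  refine (test_withSeminorms E F V).T1_of_separating fun s hs => ?_
  by_contra! h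
  refine hs (Subtype.ext (ContMDiffSection.ext fun x => ?_))
  exact smoothSeminorm_pointIndex_eq_zero.1 (h ⟨_, isLFSeminorm_smoothSeminorm (pointIndex E F V x)⟩)

theorem test_ext_of_distributions {s t : testSections E F V}
    (h : ∀ ψ : Distributions E F V, ψ s = ψ t) : s = t := by
  by_contra hst
  obtain ⟨ψ, hψ⟩ := SeparatingDual.exists_separating_of_ne (R := ℝ) hst
  exact hψ (h ψ)

theorem sectionSupport_subset_of_forall {K : Set X} (hK : IsClosed K) {s : Sections E F V}
    (h : ∀ x ∉ K, s x = 0) : sectionSupport s ⊆ K := by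
  refine closure_minimal (fun x hx => ?_) hK
  by_contra hxK
  exact hx (h x hxK)

/-- A weighted supremum of values at points that leave every compact set is continuous for the
LF-topology. -/
theorem isLFSeminorm_iSup_pointIndex (K : CompactExhaustion X) {x : ℕ → X} (hx : ∀ n, x n ∉ K n)
    (w : ℕ → ℝ≥0) :
    BddAbove (Set.range fun n => w n • smoothSeminorm (pointIndex E F V (x n))) ∧
      IsLFSeminorm (⨆ n, w n • smoothSeminorm (pointIndex E F V (x n))) := by
  classical
  set q : ℕ → Seminorm ℝ (testSections E F V) :=
    fun n => w n • smoothSeminorm (pointIndex E F V (x n)) with hq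
  have hbound : ∀ L : Set X, IsCompact L → ∃ (t : Finset (SeminormIndex E F V)) (C : ℝ≥0),
      ∀ s : testSections E F V, sectionSupport s.1 ⊆ L → ∀ n,
        q n s ≤ C * t.sup smoothSeminorm s := by
    intro L hL
    -- For `n ≥ m` the point `x n` lies outside `K n ⊇ L`, so its term vanishes on sections
    -- supported in `L`; only the finitely many `n < m` count.
    obtain ⟨m, hm⟩ := K.exists_superset_of_isCompact hL
    refine ⟨(Finset.range m).image fun n => pointIndex E F V (x n), ∑ n ∈ Finset.range m, w n,
      fun s hs n => ?_⟩
    by_cases hn : n < m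
    · have hn' := Finset.mem_range.2 hn
      have h1 : w n ≤ ∑ n ∈ Finset.range m, w n :=
        Finset.single_le_sum (f := w) (fun _ _ => zero_le) hn'
      have h2 : smoothSeminorm (pointIndex E F V (x n)) s ≤
          ((Finset.range m).image fun n => pointIndex E F V (x n)).sup smoothSeminorm s :=
        Seminorm.le_finset_sup_apply (Finset.mem_image_of_mem _ hn')
      exact mul_le_mul (by exact_mod_cast h1) h2 (apply_nonneg _ _) (NNReal.coe_nonneg _)
    · have h0 : smoothSeminorm (pointIndex E F V (x n)) s = 0 := by
        rw [smoothSeminorm_pointIndex_eq_zero]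
        by_contra h
        exact hx n (K.subset (not_lt.1 hn) (hm (hs (subset_closure h))))
      change w n • smoothSeminorm (pointIndex E F V (x n)) s ≤ _
      rw [h0, smul_zero]
      exact mul_nonneg (NNReal.coe_nonneg _) (apply_nonneg _ _)
  have hbdd : BddAbove (Set.range q) := by
    rw [Seminorm.bddAbove_range_iff]
    intro s
    obtain ⟨t, C, h⟩ := hbound _ s.2
    exact ⟨C * t.sup smoothSeminorm s, by
      rintro _ ⟨n, rfl⟩
      exact h s subset_rfl n⟩
  refine ⟨hbdd, fun L hL => ?_⟩
  obtain ⟨t, C, h⟩ := hbound L hL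
  refine ⟨t, C, fun s hs => ?_⟩
  rw [Seminorm.iSup_apply hbdd]
  exact ciSup_le (h s hs)

/-- Bounded sets of test sections have a common compact support and bounded derivatives. -/
theorem exists_boundedTests [SigmaCompactSpace X] [LocallyCompactSpace X]
    {B : Set (testSections E F V)} (hB : Bornology.IsVonNBounded ℝ B) :
    ∃ K : Set X, IsCompact K ∧ ∃ M : SeminormIndex E F V → ℝ, (∀ i, 0 ≤ M i) ∧
      B ⊆ boundedTests K M := by
  rw [(test_withSeminorms E F V).isVonNBounded_iff_seminorm_bounded] at hB
  choose M hM0 hM using fun i : SeminormIndex E F V => hB ⟨_, isLFSeminorm_smoothSeminorm i⟩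
  let K : CompactExhaustion X := default
  by_contra hcon
  have hex : ∀ n, ∃ s ∈ B, ∃ x ∉ K n, s.1 x ≠ 0 := by
    intro n
    by_contra! h
    exact hcon ⟨K n, K.isCompact n, M, fun i => (hM0 i).le, fun s hs =>
      ⟨sectionSupport_subset_of_forall (K.isCompact n).isClosed (h s hs),
        fun i => (hM i s hs).le⟩⟩
  choose s hsB x hx hsx using hex
  -- The weights give the `n`-th term the value `n` at `s n`. The supremum is then a continuous
  -- seminorm unbounded on `B`, contradicting boundedness.
  let w : ℕ → ℝ≥0 := fun n => n * (smoothSeminorm (pointIndex E F V (x n)) (s n)).toNNReal⁻¹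
  obtain ⟨hbdd, hLF⟩ := isLFSeminorm_iSup_pointIndex (E := E) (F := F) (V := V) K hx w
  obtain ⟨r, hr0, hr⟩ := hB ⟨_, hLF⟩
  obtain ⟨n, hn⟩ := exists_nat_ge r
  have h1 := hr (s n) (hsB n)
  change (⨆ n, w n • smoothSeminorm (pointIndex E F V (x n)) : Seminorm ℝ _) (s n) < r at h1
  rw [Seminorm.iSup_apply hbdd] at h1
  have h2 := le_ciSup (Seminorm.bddAbove_range_iff.1 hbdd (s n)) n
  have h3 : (w n • smoothSeminorm (pointIndex E F V (x n))) (s n) = n := by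
    change (w n : ℝ) * smoothSeminorm (pointIndex E F V (x n)) (s n) = n
    have h4 : smoothSeminorm (pointIndex E F V (x n)) (s n) ≠ 0 :=
      fun h => hsx n (smoothSeminorm_pointIndex_eq_zero.1 h)
    rw [NNReal.coe_mul, NNReal.coe_inv, Real.coe_toNNReal _ (apply_nonneg _ _), mul_assoc,
      inv_mul_cancel₀ h4, mul_one, NNReal.coe_natCast]
  simp only [h3] at h2
  linarith

theorem convex_boundedTests (K : Set X) (M : SeminormIndex E F V → ℝ) (hK : IsClosed K) :
    Convex ℝ (boundedTests K M) := by
  intro s hs t ht a b ha hb hab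
  refine ⟨sectionSupport_subset_of_forall hK fun x hx => ?_, fun i => ?_⟩
  · have h1 : s.1 x = 0 := by
      by_contra h
      exact hx (hs.1 (subset_closure h))
    have h2 : t.1 x = 0 := by
      by_contra h
      exact hx (ht.1 (subset_closure h))
    change a • s.1 x + b • t.1 x = 0
    rw [h1, h2, smul_zero, smul_zero, add_zero]
  · have hc : Convex ℝ {s | smoothSeminorm i s ≤ M i} := by
      have := (smoothSeminorm i).convexOn.convex_le (M i)
      simpa using this
    exact hc (hs.2 i) (ht.2 i) ha hb hab

theorem smul_mem_boundedTests {K : Set X} {M : SeminormIndex E F V → ℝ}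
    {s : testSections E F V} (hs : s ∈ boundedTests K M) (c : ℝ) :
    c • s ∈ boundedTests K (fun i => |c| * M i) := by
  refine ⟨(sectionSupport_subset_of_forall isClosed_closure fun x hx => ?_).trans hs.1,
    fun i => ?_⟩
  · change c • s.1 x = 0
    rw [(eventually_zero_of_notMem_support hx).self_of_nhds, smul_zero]
  · rw [map_smul_eq_mul, Real.norm_eq_abs]
    exact mul_le_mul_of_nonneg_left (hs.2 i) (abs_nonneg c)

/-- A linear form on distributions that is bounded by the supremum over a compact convex symmetric
set of test sections is the evaluation at an element of this set. -/
theorem exists_eval_of_le_on_compact {C : Set (testSections E F V)} (hC : IsCompact C)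
    (hconv : Convex ℝ C) (hsymm : ∀ s ∈ C, -s ∈ C) (h0 : (0 : testSections E F V) ∈ C)
    (Θ : Distributions E F V →ₗ[ℝ] ℝ)
    (hΘ : ∀ ψ : Distributions E F V, (∀ s ∈ C, |ψ s| ≤ 1) → |Θ ψ| ≤ 1) :
    ∃ s ∈ C, ∀ ψ : Distributions E F V, Θ ψ = ψ s := by
  classical
  -- For finitely many distributions the image of `C` in `ℝ^t` is compact and convex. Were the
  -- vector of values of `Θ` outside it, a separating functional would be pairing with a combination
  -- `ψ` of them, with `|ψ| < u` on `C` but `u < Θ ψ`, against the domination of `Θ`.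
  have key : ∀ t : Finset (Distributions E F V), (C ∩ ⋂ ψ ∈ t, {s | Θ ψ = ψ s}).Nonempty := by
    intro t
    let L : testSections E F V →L[ℝ] (t → ℝ) := ContinuousLinearMap.pi fun ψ => ψ.1
    by_contra hne
    have hnot : (fun ψ : t => Θ ψ.1) ∉ L '' C := by
      rintro ⟨s, hs, hsL⟩
      refine hne ⟨s, hs, ?_⟩
      simp only [Set.mem_iInter]
      exact fun ψ hψ => (congrFun hsL ⟨ψ, hψ⟩).symm
    obtain ⟨f, u, hfu, huf⟩ := geometric_hahn_banach_closed_point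
      (hconv.linear_image L.toLinearMap) (hC.image L.continuous).isClosed hnot
    let ψ : Distributions E F V := f.comp L
    have hΘψ : Θ ψ = f fun ψ : t => Θ ψ.1 := by
      have h1 : ∀ v : t → ℝ, f v = ∑ j, v j * f (Pi.single j 1) := by
        intro v
        conv_lhs => rw [pi_eq_sum_univ' v, map_sum]
        refine Finset.sum_congr rfl fun j _ => ?_
        rw [map_smul, smul_eq_mul]
      have h2 : ψ = ∑ j : t, f (Pi.single j 1) • j.1 := by
        ext s
        rw [sum_apply]
        refine (h1 (L s)).trans (Finset.sum_congr rfl fun j _ => ?_)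
        rw [mul_comm]
        rfl
      rw [h2, map_sum, h1]
      refine Finset.sum_congr rfl fun j _ => ?_
      rw [map_smul, smul_eq_mul, mul_comm]
    have hψC : ∀ s ∈ C, |ψ s| < u := by
      intro s hs
      rw [abs_lt]
      have h1 : ψ s < u := hfu _ ⟨s, hs, rfl⟩
      have h2 : ψ (-s) < u := hfu _ ⟨-s, hsymm s hs, rfl⟩
      rw [map_neg] at h2
      exact ⟨by linarith, h1⟩
    have hu : 0 < u := (abs_nonneg _).trans_lt (hψC 0 h0)
    have h3 := hΘ (u⁻¹ • ψ) fun s hs => by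
      change |u⁻¹ * ψ s| ≤ 1
      rw [abs_mul, abs_of_pos (inv_pos.2 hu), inv_mul_le_iff₀ hu, mul_one]
      exact (hψC s hs).le
    rw [map_smul, smul_eq_mul, abs_mul, abs_of_pos (inv_pos.2 hu), inv_mul_le_iff₀ hu, mul_one,
      hΘψ] at h3
    exact absurd (huf.trans_le ((le_abs_self _).trans h3)) (lt_irrefl u)
  -- Compactness of `C` passes from finitely many distributions to all of them simultaneously.
  obtain ⟨s, hs, hs'⟩ := hC.inter_iInter_nonempty
    (fun ψ : Distributions E F V => {s | Θ ψ = ψ s})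
    (fun ψ => isClosed_eq continuous_const ψ.continuous) key
  exact ⟨s, hs, fun ψ => Set.mem_iInter.1 hs' ψ⟩

/-- The space of test sections is semireflexive. -/
theorem exists_eval_of_continuous [SigmaCompactSpace X] [LocallyCompactSpace X]
    (Θ : Distributions E F V →ₗ[ℝ] ℝ) (hΘ : Continuous Θ) :
    ∃ s : testSections E F V, ∀ ψ : Distributions E F V, Θ ψ = ψ s := by
  have hmem : Θ ⁻¹' closedBall 0 1 ∈ 𝓝 (0 : Distributions E F V) := by
    refine hΘ.continuousAt.preimage_mem_nhds ?_
    rw [map_zero]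
    exact closedBall_mem_nhds 0 one_pos
  obtain ⟨⟨B, δ⟩, ⟨hB, hδ⟩, hsub⟩ :=
    (ContinuousLinearMap.hasBasis_nhds_zero_of_basis nhds_basis_closedBall).mem_iff.1 hmem
  simp only at hB hδ hsub
  obtain ⟨K, hK, M, hM0, hBM⟩ := exists_boundedTests hB
  have hneg : ∀ s ∈ boundedTests K (fun i => |δ⁻¹| * M i),
      -s ∈ boundedTests K (fun i => |δ⁻¹| * M i) := by
    intro s hs
    have := smul_mem_boundedTests hs (-1)
    have e : (-1 : ℝ) • s = -s := neg_one_smul ℝ s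
    rw [e] at this
    simpa using this
  -- The bounds are scaled by `δ⁻¹` so that `|ψ| ≤ 1` on the compact set forces `|ψ| ≤ δ` on `B`,
  -- which places `ψ` in the strong neighbourhood where `|Θ| ≤ 1`.
  obtain ⟨s, -, hs⟩ := exists_eval_of_le_on_compact
    (isCompact_boundedTests (M := fun i => |δ⁻¹| * M i) hK)
    (convex_boundedTests K _ hK.isClosed) hneg
    ⟨sectionSupport_subset_of_forall hK.isClosed fun x _ => rfl, fun i => by
      rw [map_zero]
      exact mul_nonneg (abs_nonneg _) (hM0 i)⟩ Θ (fun ψ hψ => by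
    have h1 : ψ ∈ Θ ⁻¹' closedBall 0 1 := by
      refine hsub fun s hs => ?_
      have h2 := hψ _ (smul_mem_boundedTests (hBM hs) δ⁻¹)
      rw [map_smul, smul_eq_mul, abs_mul, abs_of_pos (inv_pos.2 hδ), inv_mul_le_iff₀ hδ,
        mul_one] at h2
      rwa [mem_closedBall_zero_iff, Real.norm_eq_abs]
    rwa [Set.mem_preimage, mem_closedBall_zero_iff, Real.norm_eq_abs] at h1)
  exact ⟨s, hs⟩

end Manifold

/-! ### Transposition -/

section Manifold

variable {E : Type*} [NormedAddCommGroup E] [NormedSpace ℝ E]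
  {X : Type*} [TopologicalSpace X] [ChartedSpace E X] [IsManifold 𝓘(ℝ, E) ∞ X]
  {F : Type*} [NormedAddCommGroup F] [NormedSpace ℝ F]
  {V : X → Type*} [TopologicalSpace (Bundle.TotalSpace F V)]
  [∀ x, AddCommGroup (V x)] [∀ x, Module ℝ (V x)] [∀ x, TopologicalSpace (V x)]
  [FiberBundle F V] [VectorBundle ℝ F V] [ContMDiffVectorBundle ∞ F V 𝓘(ℝ, E)]

variable [FiniteDimensional ℝ E] [T2Space X] [FiniteDimensional ℝ F]

/-- The iterated commutators of transposed operators are, up to sign, transposed. -/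
theorem iterDelta_pairing {Δ : Distributions E F V →ₗ[ℝ] Distributions E F V}
    {D : testSections E F V →ₗ[ℝ] testSections E F V} (h : ∀ ψ s, Δ ψ s = ψ (D s))
    (l : List (SmoothFun E X)) (ψ : Distributions E F V) (s : testSections E F V) :
    iterDelta (K := ℝ) (P := Distributions E F V) (Q := Distributions E F V) l Δ ψ s =
      (-1 : ℝ) ^ l.length * ψ (iterDelta l D s) := by
  induction l generalizing ψ s with
  | nil => rw [List.length_nil, pow_zero, one_mul]; exact h ψ s
  | cons a l ih =>
    rw [iterDelta_cons, iterDelta_cons, delta_apply, delta_apply, sub_apply,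
      distributions_smul_apply, ih, ih, distributions_smul_apply, map_sub, List.length_cons,
      pow_succ]
    ring

/-- An operator on distributions is a differential operator of order `k` iff it is so before
transposition. -/
theorem mem_diffOps_iff_of_pairing {Δ : Distributions E F V →ₗ[ℝ] Distributions E F V}
    {D : testSections E F V →ₗ[ℝ] testSections E F V} (h : ∀ ψ s, Δ ψ s = ψ (D s)) (k : ℕ) :
    Δ ∈ diffOps ℝ (SmoothFun E X) (Distributions E F V) (Distributions E F V) k ↔
      D ∈ diffOps ℝ (SmoothFun E X) (testSections E F V) (testSections E F V) k := by
  rw [mem_diffOps_iff, mem_diffOps_iff]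
  refine forall₂_congr fun l _ => ⟨fun hl => ?_, fun hl => ?_⟩
  · refine LinearMap.ext fun s => test_ext_of_distributions fun ψ => ?_
    have h1 := iterDelta_pairing h l ψ s
    rw [hl, LinearMap.zero_apply, zero_apply, eq_comm, mul_eq_zero] at h1
    rw [LinearMap.zero_apply, map_zero]
    exact h1.resolve_left (pow_ne_zero _ (by norm_num))
  · refine LinearMap.ext fun ψ => ContinuousLinearMap.ext fun s => ?_
    rw [iterDelta_pairing h, hl, LinearMap.zero_apply, map_zero, mul_zero]
    rfl

/-- A continuous linear map sends bounded sets to bounded sets, so precomposition respects uniform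
convergence on bounded sets. -/
theorem continuous_transpose (D : testSections E F V →L[ℝ] testSections E F V) :
    Continuous (transpose D) :=
  (ContinuousLinearMap.precomp ℝ D).continuous

/-- A continuous endomorphism of the space of distributions is a transpose. -/
theorem exists_pairing_of_continuous [SigmaCompactSpace X] [LocallyCompactSpace X]
    {Δ : Distributions E F V →ₗ[ℝ] Distributions E F V} (hΔ : Continuous Δ) :
    ∃ D : testSections E F V →ₗ[ℝ] testSections E F V, ∀ ψ s, Δ ψ s = ψ (D s) := by
  have hex : ∀ s : testSections E F V, ∃ t : testSections E F V,
      ∀ ψ : Distributions E F V, Δ ψ s = ψ t := by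
    intro s
    let ev : Distributions E F V →ₗ[ℝ] ℝ :=
      { toFun := fun ψ => ψ s
        map_add' := fun _ _ => rfl
        map_smul' := fun _ _ => rfl }
    have hev : Continuous ev := continuous_eval_const s
    exact exists_eval_of_continuous (ev ∘ₗ Δ) (hev.comp hΔ)
  -- The chosen section is determined by its pairings with all distributions, which forces
  -- linearity. Continuity of `D` is not sought here: for differential operators it comes from
  -- `continuous_of_mem_diffOps`.
  choose D hD using hex
  refine ⟨⟨⟨D, fun s t => ?_⟩, fun c s => ?_⟩, fun ψ s => hD s ψ⟩
  · refine test_ext_of_distributions fun ψ => ?_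
    rw [← hD, map_add, map_add, ← hD, ← hD]
  · refine test_ext_of_distributions fun ψ => ?_
    rw [← hD, map_smul, map_smul, ← hD]
    rfl

variable (E F V) in
/-- Transposition as a bijection of the differential operators of order `k` on test sections onto
the continuous differential operators of order `k` on distributions. -/
def transposeEquiv [SigmaCompactSpace X] [LocallyCompactSpace X] (k : ℕ) :
    diffOps ℝ (SmoothFun E X) (testSections E F V) (testSections E F V) k ≃
      {Δ : Distributions E F V →ₗ[ℝ] Distributions E F V //
        Δ ∈ diffOps ℝ (SmoothFun E X) (Distributions E F V) (Distributions E F V) k ∧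
          Continuous Δ} :=
  Equiv.ofBijective
    (fun D => ⟨transpose ⟨D.1, continuous_of_mem_diffOps D.2⟩,
      (mem_diffOps_iff_of_pairing (fun _ _ => rfl) k).2 D.2, continuous_transpose _⟩) <| by
    constructor
    · intro D D' h
      refine Subtype.ext (LinearMap.ext fun s => test_ext_of_distributions fun ψ => ?_)
      have h1 := congrArg Subtype.val h
      exact congrArg (fun Δ : Distributions E F V →ₗ[ℝ] Distributions E F V => Δ ψ s) h1
    · rintro ⟨Δ, hΔ, hc⟩
      obtain ⟨D, hD⟩ := exists_pairing_of_continuous hc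
      refine ⟨⟨D, (mem_diffOps_iff_of_pairing hD k).1 hΔ⟩, Subtype.ext (LinearMap.ext fun ψ =>
        ContinuousLinearMap.ext fun s => (hD ψ s).symm)⟩

end Manifold

end DistOp

end

/-! ### The theorem -/

theorem theorem220
    {E : Type*} [NormedAddCommGroup E] [NormedSpace ℝ E] [FiniteDimensional ℝ E]
    {X : Type*} [TopologicalSpace X] [T2Space X] [SecondCountableTopology X]
    [ChartedSpace E X] [IsManifold 𝓘(ℝ, E) ∞ X]
    {F : Type*} [NormedAddCommGroup F] [NormedSpace ℝ F] [FiniteDimensional ℝ F]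
    {V : X → Type*} [TopologicalSpace (Bundle.TotalSpace F V)]
    [∀ x, AddCommGroup (V x)] [∀ x, Module ℝ (V x)] [∀ x, TopologicalSpace (V x)]
    [FiberBundle F V] [VectorBundle ℝ F V] [ContMDiffVectorBundle ∞ F V 𝓘(ℝ, E)] :
    (∀ Δ : DistOp.Distributions E F V →ₗ[ℝ] DistOp.Distributions E F V,
      DistOp.IsDiffOp ℝ (DistOp.SmoothFun E X)
          (DistOp.Distributions E F V) (DistOp.Distributions E F V) Δ →
        ((∃ D : DistOp.testSections E F V →L[ℝ] DistOp.testSections E F V,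
            DistOp.IsDiffOp ℝ (DistOp.SmoothFun E X)
              (DistOp.testSections E F V) (DistOp.testSections E F V) D.toLinearMap ∧ DistOp.transpose D = Δ) ↔
          Continuous Δ)) ∧
    ∀ k : ℕ,
      ∃ (Φ : DistOp.jetDualSections E F V k ≃ₗ[DistOp.SmoothFun E X]
            DistOp.diffOps ℝ (DistOp.SmoothFun E X)
              (DistOp.testSections E F V) (DistOp.testSections E F V) k)
        (T : DistOp.diffOps ℝ (DistOp.SmoothFun E X)
              (DistOp.testSections E F V) (DistOp.testSections E F V) k ≃
            {Δ : DistOp.Distributions E F V →ₗ[ℝ] DistOp.Distributions E F V //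
              Δ ∈ DistOp.diffOps ℝ (DistOp.SmoothFun E X)
                (DistOp.Distributions E F V) (DistOp.Distributions E F V) k ∧ Continuous Δ}),
        (∀ (A : DistOp.jetDualSections E F V k) (s : DistOp.testSections E F V) (x : X),
          ((Φ A).1 s).1 x = DistOp.contract (A.1 x) (DistOp.jet k x s.1)) ∧
        ∀ D : DistOp.diffOps ℝ (DistOp.SmoothFun E X)
              (DistOp.testSections E F V) (DistOp.testSections E F V) k,
          ∃ hD : Continuous D.1, (T D).1 = DistOp.transpose ⟨D.1, hD⟩ := by
  -- With second countability this yields σ-compactness, hence the compact exhaustion behind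
  -- `exists_boundedTests`.
  have : LocallyCompactSpace X := ChartedSpace.locallyCompactSpace E X
  refine ⟨fun Δ hΔ => ⟨?_, fun hc => ?_⟩, fun k => ⟨DistOp.jetOperatorEquiv E F V k,
    DistOp.transposeEquiv E F V k, fun A s x => rfl,
    fun D => ⟨DistOp.continuous_of_mem_diffOps D.2, rfl⟩⟩⟩
  · rintro ⟨D, -, rfl⟩
    exact DistOp.continuous_transpose D
  · obtain ⟨k, hk⟩ := hΔ
    obtain ⟨D, hD⟩ := (DistOp.transposeEquiv E F V k).surjective ⟨Δ, hk, hc⟩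
    exact ⟨⟨D.1, DistOp.continuous_of_mem_diffOps D.2⟩, ⟨k, D.2⟩, congrArg Subtype.val hD⟩
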